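/- Let $\Sigma$ be a finite nonempty alphabet. The residual languages of $L\subseteq\Sigma^*$ are $\mathrm{Res}(L)=\{u^{-1}L\mid u\in\Sigma^*\}$ with $u^{-1}L=\{v\mid uv\in L\}$. A language $K\in\mathrm{Res}(L)$ is prime if it is not the union of the members of $\mathrm{Res}(L)$ strictly contained in $K$. The canonical residual finite automaton (RFA) of a regular $L$ is the nondeterministic finite automaton (NFA) whose states are the primes of $\mathrm{Res}(L)$, with initial states the primes $K\subseteq L$, final states the primes $K\ni\varepsilon$, and $K'\in\delta(K,a)$ iff $K'\subseteq a^{-1}K$. A learner has access to a minimally adequate teacher for an unknown regular target $L$: a membership query (MQ) on $w$ is answered by whether $w\in L$; an equivalence query (EQ) on an NFA $\mathcal H$ is answered by "yes" if $L(\mathcal H)=L$, and otherwise by an arbitrary, possibly adaptively chosen, counterexample $w\in L\,\triangle\,L(\mathcal H)$. For a run of the learner, let $n=|\mathrm{Res}(L)|$ and let $m$ be the length of the longest counterexample received ($\log m$ is read as $0$ if there is none or $m=0$). Consider the following variant of the learner $\mathsf{NL}^*$, with an observation table of rows $U\cup U\Sigma$ and columns $V$ (initially $U=V=\{\varepsilon\}$)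 where $\mathrm{row}(x)=\{v\in V\mid xv\in L\}$ is found by MQs that are never repeated. Let $Q$ be the set of $u\in U$ with $\mathrm{row}(u)$ prime among all rows. The hypothesis has states $Q$; $q$ is initial iff $\mathrm{row}(q)\subseteq\mathrm{row}(\varepsilon)$ and final iff $\varepsilon\in\mathrm{row}(q)$; and $q'\in\delta(q,a)$ iff $\mathrm{row}(q')\subseteq\mathrm{row}(qa)$. The learner repeats the first applicable step: (1) if $\mathrm{row}(ua)$ is prime and different from all $\mathrm{row}(u')$, $u'\in U$, add $ua$ to $U$; (2) if $\mathrm{row}(u)\subseteq\mathrm{row}(u')$, $uav\in L$ and $u'av\notin L$ for some $u,u'\in U$, $a\in\Sigma$, $v\in V$, add $av$ to $V$; (3) if for some $v\in V$, $q\in Q$ one has $v\in\mathrm{row}(q)\Leftrightarrow v\notin L_q$ ($L_q$ being the language accepted from $q$), take a shortest such $v$, find by binary search over its suffixes a suffix $av'$ ($a\in\Sigma$) such that $qv'\in L\Leftrightarrow v'\in L_q$ for all $q\in Q$, but not $qav'\in L\Leftrightarrow av'\in L_q$ for all $q\in Q$, and add $v'$ to $V$; (4) otherwise ask an EQ on the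 hypothesis and output it on "yes". On a counterexample $w$: if $\bigvee_{q\in Q_0}[qw\in L]\ne[w\in L]$, where $Q_0$ is the set of initial states, add $w$ to $V$; otherwise find by binary search a decomposition $w=uav$ with $\bigvee_{q\in\delta(Q_0,u)}[qav\in L]\neq\bigvee_{q'\in\delta(Q_0,ua)}[q'v\in L]$ and add $v$ to $V$. There is an absolute constant $C$ such that, for every finite nonempty alphabet $\Sigma$: (a) for every regular $L\subseteq\Sigma^*$ and every teacher for $L$, this learner halts and outputs an NFA that accepts $L$ and is isomorphic to the canonical RFA of $L$, after at most $Cn^2$ EQs and at most $C(n^3|\Sigma|+n^3\log m)$ MQs; (b) there is a learner (a deterministic adaptive query strategy, depending on $\Sigma$ but not on $L$ or the teacher) that, for every regular $L\subseteq\Sigma^*$ and every teacher for $L$, halts and outputs an NFA that accepts $L$ and is isomorphic to the canonical RFA of $L$, after at most $Cn^2$ EQs and at most $C(n^3|\Sigma|+n\log m)$ MQs. -/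

import Mathlib

namespace RFA

/-! ### Residual languages, primes, canonical RFA -/

/-- `Res(L)`: the residual languages `u⁻¹L = {v | u v ∈ L}` of `L`. -/
def residuals {α : Type} (L : Language α) : Set (Language α) :=
  Set.range L.leftQuotient

/-- `Prm(C)`: the members of `C` that are not the union of the members of `C` which they
strictly contain. -/
def primes {α : Type} (C : Set (Language α)) : Set (Language α) :=
  {K | K ∈ C ∧ K ≠ sSup {K' | K' ∈ C ∧ K' < K}}

/-- The canonical residual finite automaton of `L`. -/
def canonicalRFA {α : Type} (L : Language α) : NFA α (primes (residuals L)) where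
  start := {K | K.1 ≤ L}
  accept := {K | [] ∈ K.1}
  step K a := {K' | K'.1 ≤ K.1.leftQuotient [a]}

/-- Isomorphisms of nondeterministic finite automata. -/
structure NFAIso {α σ τ : Type} (M : NFA α σ) (N : NFA α τ) where
  toEquiv : σ ≃ τ
  start_iff : ∀ q, toEquiv q ∈ N.start ↔ q ∈ M.start
  accept_iff : ∀ q, toEquiv q ∈ N.accept ↔ q ∈ M.accept
  step_iff : ∀ q a q', toEquiv q' ∈ N.step (toEquiv q) a ↔ q' ∈ M.step q a

/-- A concretely presented nondeterministic finite automaton, with states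
`0, …, size - 1`. -/
structure FinNFA (α : Type) where
  size : ℕ
  init : Fin size → Bool
  final : Fin size → Bool
  trans : Fin size → α → Fin size → Bool

/-- The automaton as an `NFA` of Mathlib. -/
def FinNFA.toNFA {α : Type} (H : FinNFA α) : NFA α (Fin H.size) where
  start := {q | H.init q = true}
  accept := {q | H.final q = true}
  step q a := {q' | H.trans q a q' = true}

/-- The language accepted by the automaton. -/
def FinNFA.lang {α : Type} (H : FinNFA α) : Language α := H.toNFA.accepts

/-! ### Learning with a minimally adequate teacher (MAT) -/

/-- Query programs: return a result, ask a membership query (MQ) and go on according to the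
answer, or ask an equivalence query (EQ) and go on according to the answer, which is `none`
for "yes" and `some w` for a counterexample `w`. -/
inductive Prog (α β : Type) : Type
  | ret (b : β) : Prog α β
  | memberQ (w : List α) (k : Bool → Prog α β) : Prog α β
  | equivQ (H : FinNFA α) (k : Option (List α) → Prog α β) : Prog α β

/-- Sequential composition of query programs. -/
def Prog.bind {α β γ : Type} : Prog α β → (β → Prog α γ) → Prog α γ
  | .ret b, f => f b
  | .memberQ w k, f => .memberQ w fun b => (k b).bind f
  | .equivQ H k, f => .equivQ H fun r => (k r).bind f

/-- One query together with its answer. -/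
inductive Event (α : Type) : Type
  | member (w : List α) (b : Bool) : Event α
  | equiv (H : FinNFA α) (r : Option (List α)) : Event α

/-- A record of the queries asked so far and of their answers, the latest one first. -/
abbrev Transcript (α : Type) : Type := List (Event α)

/-- Number of membership queries (repeated ones are counted each time). -/
def numMQ {α : Type} : Transcript α → ℕ
  | [] => 0
  | .member _ _ :: t => numMQ t + 1
  | .equiv _ _ :: t => numMQ t

/-- Number of equivalence queries (including the one answered "yes"). -/
def numEQ {α : Type} : Transcript α → ℕ
  | [] => 0
  | .member _ _ :: t => numEQ t
  | .equiv _ _ :: t => numEQ t + 1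

/-- Length of the longest counterexample received (`0` if there was none). -/
def maxCex {α : Type} : Transcript α → ℕ
  | [] => 0
  | .member _ _ :: t => maxCex t
  | .equiv _ none :: t => maxCex t
  | .equiv _ (some w) :: t => max w.length (maxCex t)

/-- A teacher for the target `L`, given by its answers to equivalence queries. They are correct,
but the counterexamples are arbitrary and may depend on the whole transcript. -/
structure Teacher {α : Type} (L : Language α) where
  reply : Transcript α → FinNFA α → Option (List α)
  reply_none_iff : ∀ t H, reply t H = none ↔ H.lang = L
  reply_some : ∀ t H w, reply t H = some w → (w ∈ L ∧ w ∉ H.lang) ∨ (w ∈ H.lang ∧ w ∉ L)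

open Classical in
/-- Execution of a query program against a teacher; membership queries are answered truthfully. -/
noncomputable def Prog.exec {α β : Type} {L : Language α} (T : Teacher L) :
    Prog α β → Transcript α → β × Transcript α
  | .ret b, t => (b, t)
  | .memberQ w k, t => (k (decide (w ∈ L))).exec T (.member w (decide (w ∈ L)) :: t)
  | .equivQ H k, t => (k (T.reply t H)).exec T (.equiv H (T.reply t H) :: t)

/-- A learner repeats rounds, each of which is a query program that ends with a new state
or with the final output. It does not know the target or the teacher. -/
structure Learner (α : Type) where
  State : Type
  start : State
  round : State → Prog α (State ⊕ FinNFA α)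

/-- From state `s` with transcript `t`, the learner halts after finitely many rounds with output
`H` and transcript `t'`. -/
inductive Learner.Halts {α : Type} (M : Learner α) {L : Language α} (T : Teacher L) :
    M.State → Transcript α → FinNFA α → Transcript α → Prop
  | done {s t H t'} : (M.round s).exec T t = (Sum.inr H, t') → M.Halts T s t H t'
  | more {s t s' t' H t''} : (M.round s).exec T t = (Sum.inl s', t') →
      M.Halts T s' t' H t'' → M.Halts T s t H t''

/-- The whole run of the learner against the teacher halts with output `H` and transcript `t`.
As everything is deterministic, there is at most one such pair. -/
def Learner.Run {α : Type} (M : Learner α) {L : Language α} (T : Teacher L)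
    (H : FinNFA α) (t : Transcript α) : Prop :=
  M.Halts T M.start [] H t

/-! ### The learner: `NL*` with binary search in place of suffix-closed columns -/

/-- The answers to membership queries received so far. -/
abbrev Memo (α : Type) : Type := List (List α × Bool)

/-- `Obs α`: an observation table with row strings `U`, column strings `V` and memory `T`. -/
structure Obs (α : Type) where
  U : List (List α)
  V : List (List α)
  T : Memo α

section Learner

variable {α : Type} [FinEnum α]

/-- The stored answer for `w` is `+`. -/
def val (T : Memo α) (w : List α) : Bool := T.lookup w == some true

/-- Ask MQs for those of the given strings whose answer is not known yet. -/
def askAll : List (List α) → Memo α → Prog α (Memo α)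
  | [], T => .ret T
  | w :: ws, T =>
    if (T.lookup w).isSome then askAll ws T
    else .memberQ w fun b => askAll ws ((w, b) :: T)

/-- Binary search for an `i` at which a test changes from false at `i` to true at `i + 1`,
given that it is false at the left end and true at the right end of the interval. The MQs needed for
the test at `i` are those on `ws i`. -/
def bsearch (ws : ℕ → List (List α)) (test : Memo α → ℕ → Bool) (i j : ℕ) (T : Memo α) :
    Prog α (ℕ × Memo α) :=
  if j ≤ i + 1 then .ret (i, T)
  else (askAll (ws ((i + j) / 2)) T).bind fun T' =>
    if test T' ((i + j) / 2) then bsearch ws test i ((i + j) / 2) T'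
    else bsearch ws test ((i + j) / 2) j T'
termination_by j - i

namespace Obs

/-- The lower rows `U Σ`. -/
def lower (S : Obs α) : List (List α) :=
  S.U.flatMap fun u => (FinEnum.toList α).map fun a => u ++ [a]

/-- All row strings, `U ∪ U Σ`. -/
def rows (S : Obs α) : List (List α) := S.U ++ S.lower

/-- All strings whose membership belongs to the table, `(U ∪ U Σ) V`. -/
def cells (S : Obs α) : List (List α) :=
  S.rows.flatMap fun x => S.V.map fun v => x ++ v

/-- `row(x) ⊆ row(y)`. -/
def rowLe (S : Obs α) (x y : List α) : Bool :=
  S.V.all fun v => !val S.T (x ++ v) || val S.T (y ++ v)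

/-- `row(x)` is prime among the rows of the table: some column with `+` in `row(x)` has `-` in
all rows strictly contained in `row(x)`. -/
def isPrime (S : Obs α) (x : List α) : Bool :=
  S.V.any fun v => val S.T (x ++ v) &&
    S.rows.all fun y => !(S.rowLe y x && !S.rowLe x y) || !val S.T (y ++ v)

/-- A lower row that is prime but equal to no upper row, if there is one. -/
def unclosed (S : Obs α) : Option (List α) :=
  S.lower.find? fun x => S.isPrime x && S.U.all fun u => !(S.rowLe x u && S.rowLe u x)

/-- A string `a v` with `v ∈ V` such that, for some `u, u' ∈ U` with `row(u) ⊆ row(u')`, the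
table has `+` at `(u a, v)` and `-` at `(u' a, v)`, if there is one. -/
def inconsistent (S : Obs α) : Option (List α) :=
  (S.U.flatMap fun u => S.U.flatMap fun u' => (FinEnum.toList α).flatMap fun a =>
    (S.V.filter fun v => S.rowLe u u' && val S.T (u ++ [a] ++ v) && !val S.T (u' ++ [a] ++ v)).map
      fun v => a :: v).head?

/-- The states `Q` of the hypothesis: the strings of `U` with prime rows. -/
def states (S : Obs α) : List (List α) := S.U.filter S.isPrime

/-- The initial states `Q₀` of the hypothesis. -/
def initial (S : Obs α) : List (List α) := S.states.filter fun q => S.rowLe q []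

/-- One step of the hypothesis from a set of states, with `q' ∈ δ(q, a)` if and only if
`row(q') ⊆ row(q a)`. -/
def stepSet (S : Obs α) (P : List (List α)) (a : α) : List (List α) :=
  S.states.filter fun q' => P.any fun q => S.rowLe q' (q ++ [a])

/-- `δ(P, w)`. -/
def reach (S : Obs α) (P : List (List α)) (w : List α) : List (List α) := w.foldl S.stepSet P

/-- `w ∈ L_q` for the hypothesis. -/
def accFrom (S : Obs α) (q w : List α) : Bool := (S.reach [q] w).any fun q' => val S.T q'

/-- The hypothesis automaton. -/
def hyp (S : Obs α) : FinNFA α where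
  size := S.states.length
  init i := S.rowLe S.states[i] []
  final i := val S.T S.states[i]
  trans i a j := S.rowLe S.states[j] (S.states[i] ++ [a])

/-- `MQ(q s) = +` iff `s ∈ L_q`, for all states `q`. -/
def agrees (S : Obs α) (T : Memo α) (s : List α) : Bool :=
  S.states.all fun q => val T (q ++ s) == S.accFrom q s

/-- A shortest column string `v ∈ V` such that `v ∈ row(q)` iff `v ∉ L_q` for some state `q`,
if there is one. -/
def badColumn (S : Obs α) : Option (List α) :=
  S.V.find? fun v => !S.agrees S.T v &&
    S.V.all fun v' => S.agrees S.T v' || decide (v.length ≤ v'.length)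

/-- Extend the table by a row, with the given memory. -/
def addRow (S : Obs α) (T : Memo α) (u : List α) : Obs α := ⟨S.U ++ [u], S.V, T⟩

/-- Extend the table by a column, with the given memory. -/
def addCol (S : Obs α) (T : Memo α) (v : List α) : Obs α := ⟨S.U, S.V ++ [v], T⟩

/-- The disjunction of `MQ(q w₂)` over the states `q ∈ δ(Q₀, w₁)`, where `w = w₁ w₂` with
`|w₁| = i`. -/
def disj (S : Obs α) (T : Memo α) (w : List α) (i : ℕ) : Bool :=
  (S.reach S.initial (w.take i)).any fun q => val T (q ++ w.drop i)

/-- Repair of a column `v` on which rows and hypothesis disagree: binary search for a suffix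
`a v'` of `v` such that `v'` is good and `a v'` is bad for the hypothesis, and extension of the
table by the column `v'`. -/
def repair (S : Obs α) (v : List α) : Prog α (Obs α) :=
  (bsearch (fun i => S.states.map fun q => q ++ v.drop i) (fun T i => S.agrees T (v.drop i))
    0 v.length S.T).bind fun r => .ret (S.addCol r.2 (v.drop (r.1 + 1)))

/-- Processing of a counterexample `w`: if the initial states do not explain `MQ(w)`, the
column `w` is added; otherwise binary search gives a decomposition `w = u a v` such that the
disjunction of `MQ(q a v)` over `q ∈ δ(Q₀, u)` differs from the disjunction of `MQ(q v)` over
`q ∈ δ(Q₀, u a)`, and the column `v` is added. -/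
def refine (S : Obs α) (w : List α) : Prog α (Obs α) :=
  (askAll (w :: S.initial.map fun q => q ++ w) S.T).bind fun T =>
    if S.disj T w 0 != val T w then .ret (S.addCol T w)
    else
      (bsearch (fun i => (S.reach S.initial (w.take i)).map fun q => q ++ w.drop i)
        (fun T' i => S.disj T' w i != val T w) 0 w.length T).bind fun r =>
          .ret (S.addCol r.2 (w.drop (r.1 + 1)))

/-- What the learner does with a completely filled table. -/
def act (S : Obs α) : Prog α (Obs α ⊕ FinNFA α) :=
  match S.unclosed with
  | some x => .ret (.inl (S.addRow S.T x))
  | none =>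
    match S.inconsistent with
    | some v => .ret (.inl (S.addCol S.T v))
    | none =>
      match S.badColumn with
      | some v => (S.repair v).bind fun S' => .ret (.inl S')
      | none => .equivQ S.hyp fun
        | none => .ret (.inr S.hyp)
        | some w => (S.refine w).bind fun S' => .ret (.inl S')

end Obs

end Learner

/-- The residual automata learner `NL*`, with the columns of the observation table no longer
closed under suffixes: counterexamples are processed by binary search, and disagreement between the
table and the hypothesis is repaired by binary search before an EQ is asked. -/
def binaryNLStar (α : Type) [FinEnum α] : Learner α where
  State := Obs α
  start := ⟨[[]], [[]], []⟩
  round S := (askAll S.cells S.T).bind fun T => Obs.act ⟨S.U, S.V, T⟩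

end RFA

namespace RFA

/-! ### Tables of residual languages -/

section Abstract

variable {α : Type}

/-! Let `R` be the set of residuals of the row strings and `n` the number of all residuals.
Everything rests on `potential`, which combines the number of upper rows, of non-included pairs in
`R`, of members of `R`, of distinct rows and of members with prime rows. It is at most `7 * n ^ 2`
(`potential_le`), and every round that does not halt raises it. Prime rows are the only ingredient
that can be lost, and they are lost only when `R` or the number of distinct rows grows; the weight
`n + 1` on these two pays for the loss.

A column that leaves the potential unchanged changes neither the order of the rows nor their
primality (`potential_col`). In a closed table such a column `v` still obeys the rule that `x v` is
in `L` iff `q v` is in `L` for some state `q` whose row is below that of `x`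
(`Obs.Filled.mem_iff_exists_state`). The suffixes found by binary search, in a repair or on a
counterexample, and the counterexamples not explained by the initial states violate this rule, so
they make progress (`Obs.Filled.pot_lt_addCol`).

When an EQ is answered "yes", the table is closed and consistent, and states and hypothesis agree on
all columns. A state `q` is itself an upper row string, and reading it leads only to states with
rows below that of `q`. One of these accepts the column witnessing the primality of `q`, hence has
the same row. So each state accepts exactly its residual (`Obs.accFrom_iff_mem`), and the states are
the primes of `L` (`Obs.nonempty_iso_hyp`).

For the MQs, the memory never stores a string twice. Its size is at most the number of cells plus
the number of strings asked outside the table, which arise only in searches. Columns may become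
longer than `m` through consistency steps, but the suffixes that start in the part prepended by such
steps are columns already, and tests on them are free. Hence each search costs about `n log m`.

For (b), deterministic hypotheses are used instead: the number of upper rows plus the number of
distinct rows is at most `2 * n`, and a test needs one MQ. The canonical RFA of the final hypothesis
is then obtained without queries. -/

/-- Inclusion of the rows of `K` and `K'` with columns `V`. -/
def RowLE (V : Set (List α)) (K K' : Language α) : Prop := ∀ v ∈ V, v ∈ K → v ∈ K'

/-- The row of `K` with columns `V`. -/
def rowOf (V : Set (List α)) (K : Language α) : Set (List α) := {v | v ∈ V ∧ v ∈ K}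

/-- The pairs of members of `R` whose rows are not included in each other. -/
def sepPairs (R : Set (Language α)) (V : Set (List α)) : Set (Language α × Language α) :=
  {p | p.1 ∈ R ∧ p.2 ∈ R ∧ ¬ RowLE V p.1 p.2}

/-- The members of `R` whose rows are prime. -/
def primeRows (R : Set (Language α)) (V : Set (List α)) : Set (Language α) :=
  {K | K ∈ R ∧ ∃ v ∈ V, v ∈ K ∧ ∀ K' ∈ R, RowLE V K' K → ¬ RowLE V K K' → v ∉ K'}

/-- A measure of the size of a table with `k` upper rows, which all steps of the learner
increase. -/
noncomputable def potential (n k : ℕ) (R : Set (Language α)) (V : Set (List α)) : ℕ :=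
  -- At most `n` prime rows can be lost in a step, so a gain of one in a term of weight `n + 1`
  -- always outweighs the loss.
  k + (sepPairs R V).ncard + (n + 1) * (R.ncard + (rowOf V '' R).ncard) + (primeRows R V).ncard

variable {R R' : Set (Language α)} {V V' : Set (List α)} {K K' : Language α}

theorem RowLE.refl (V : Set (List α)) (K : Language α) : RowLE V K K := fun _ _ h => h

theorem RowLE.trans {K₁ K₂ K₃ : Language α} (h : RowLE V K₁ K₂) (h' : RowLE V K₂ K₃) :
    RowLE V K₁ K₃ := fun v hv hk => h' v hv (h v hv hk)

theorem RowLE.anti (hV : V ⊆ V') (h : RowLE V' K K') : RowLE V K K' :=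
  fun v hv hk => h v (hV hv) hk

theorem rowOf_eq_iff : rowOf V K = rowOf V K' ↔ RowLE V K K' ∧ RowLE V K' K := by
  simp only [rowOf, Set.ext_iff, Set.mem_ofPred_eq, RowLE]
  constructor
  · intro h
    exact ⟨fun v hv hk => ((h v).1 ⟨hv, hk⟩).2, fun v hv hk => ((h v).2 ⟨hv, hk⟩).2⟩
  · rintro ⟨h₁, h₂⟩ v
    exact ⟨fun h => ⟨h.1, h₁ v h.1 h.2⟩, fun h => ⟨h.1, h₂ v h.1 h.2⟩⟩

/-- Each row is the union of the prime rows included in it. -/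
theorem exists_primeRow (hR : R.Finite) (hK : K ∈ R) {v : List α} (hv : v ∈ V) (hvK : v ∈ K) :
    ∃ K' ∈ primeRows R V, RowLE V K' K ∧ v ∈ K' := by
  -- Among the rows below `K` that contain `v`, a minimal one is prime, with `v` itself as witness.
  -- Minimality is measured by the number of members of `R` below it.
  obtain ⟨K₀, ⟨hK₀, hle, hvK₀⟩, hmin⟩ := Set.exists_min_image
    {K' | K' ∈ R ∧ RowLE V K' K ∧ v ∈ K'} (fun K' => {K'' | K'' ∈ R ∧ RowLE V K'' K'}.ncard)
    (hR.subset fun _ h => h.1) ⟨K, hK, .refl V K, hvK⟩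
  refine ⟨K₀, ⟨hK₀, v, hv, hvK₀, fun K' hK' h₁ h₂ hvK' => ?_⟩, hle, hvK₀⟩
  refine absurd (hmin K' ⟨hK', h₁.trans hle, hvK'⟩) (not_le.2 ?_)
  refine Set.ncard_lt_ncard ⟨fun K'' h => ⟨h.1, h.2.trans h₁⟩, fun h => ?_⟩
    (hR.subset fun _ h => h.1)
  exact h₂ (h ⟨hK₀, .refl V K₀⟩).2

theorem mem_primes_iff {C : Set (Language α)} :
    K ∈ primes C ↔ K ∈ C ∧ ∃ v ∈ K, ∀ K' ∈ C, K' < K → v ∉ K' := by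
  simp only [primes, Set.mem_ofPred_eq, and_congr_right_iff]
  intro _
  have hle : sSup {K' | K' ∈ C ∧ K' < K} ≤ K := sSup_le fun _ h => h.2.le
  have hmem : ∀ v, v ∈ sSup {K' | K' ∈ C ∧ K' < K} ↔ ∃ K', (K' ∈ C ∧ K' < K) ∧ v ∈ K' :=
    fun v => by
      change v ∈ ⋃₀ {K' : Set (List α) | K' ∈ C ∧ K' < K} ↔ _
      exact Set.mem_sUnion
  constructor
  · intro h
    by_contra! hc
    refine h (le_antisymm (fun v hv => ?_) hle)
    obtain ⟨K', h₁, h₂, h₃⟩ := hc v hv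
    exact (hmem v).2 ⟨K', ⟨h₁, h₂⟩, h₃⟩
  · rintro ⟨v, hv, h⟩ he
    rw [he] at hv
    obtain ⟨K', ⟨h₁, h₂⟩, h₃⟩ := (hmem v).1 hv
    exact h K' h₁ h₂ h₃

theorem rowLE_univ : RowLE Set.univ K K' ↔ K ≤ K' :=
  ⟨fun h v hv => h v trivial hv, fun h _ _ hv => h hv⟩

/-- With all words as columns, rows are languages, so results on tables specialise to residual
languages. -/
theorem primeRows_univ (C : Set (Language α)) : primeRows C Set.univ = primes C := by
  ext K
  simp only [mem_primes_iff, primeRows, Set.mem_ofPred_eq, rowLE_univ, Set.mem_univ, true_and,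
    lt_iff_le_not_ge, and_imp]

/-- In a finite family, each language is the union of the primes included in it. -/
theorem exists_prime_le {C : Set (Language α)} (hC : C.Finite) (hK : K ∈ C) {v : List α}
    (hv : v ∈ K) : ∃ K' ∈ primes C, K' ≤ K ∧ v ∈ K' := by
  obtain ⟨K', h₁, h₂, h₃⟩ := exists_primeRow (V := Set.univ) hC hK trivial hv
  exact ⟨K', primeRows_univ C ▸ h₁, rowLE_univ.1 h₂, h₃⟩

theorem sepPairs_subset : sepPairs R V ⊆ R ×ˢ R := fun _ h => ⟨h.1, h.2.1⟩

theorem sepPairs_mono (hR : R ⊆ R') (hV : V ⊆ V') : sepPairs R V ⊆ sepPairs R' V' :=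
  fun _ h => ⟨hR h.1, hR h.2.1, fun h' => h.2.2 (h'.anti hV)⟩

theorem primeRows_subset : primeRows R V ⊆ R := fun _ h => h.1

theorem finite_sepPairs (hR : R.Finite) : (sepPairs R V).Finite :=
  (hR.prod hR).subset sepPairs_subset

/-- The summands are at most `n`, `n ^ 2`, `2 * n * (n + 1)` and `n`, and `3 * n ^ 2 + 4 * n ≤ 7 * n
^ 2`. -/
theorem potential_le {n k : ℕ} (hR : R.Finite) (hn : R.ncard ≤ n) (hk : k ≤ n) (h1 : 1 ≤ n) :
    potential n k R V ≤ 7 * n ^ 2 := by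
  have h₁ : (sepPairs R V).ncard ≤ n ^ 2 := by
    refine (Set.ncard_le_ncard sepPairs_subset (hR.prod hR)).trans ?_
    rw [Set.ncard_prod, sq]
    exact Nat.mul_le_mul hn hn
  have h₂ : (rowOf V '' R).ncard ≤ n := (Set.ncard_image_le hR).trans hn
  have h₃ : (primeRows R V).ncard ≤ n := (Set.ncard_le_ncard primeRows_subset hR).trans hn
  have h₄ : (n + 1) * (R.ncard + (rowOf V '' R).ncard) ≤ (n + 1) * (n + n) :=
    Nat.mul_le_mul_left _ (Nat.add_le_add hn h₂)
  unfold potential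
  nlinarith

/-- Restriction of columns maps the long rows onto the short ones. So their number cannot drop when
columns are added, and if it stays the same, restriction is injective. -/
theorem rowOf_image_of_subset (hV : V ⊆ V') :
    rowOf V '' R = (fun r => {v | v ∈ V ∧ v ∈ r}) '' (rowOf V' '' R) := by
  rw [Set.image_image]
  refine Set.image_congr fun K _ => ?_
  ext v
  simp only [rowOf, Set.mem_ofPred_eq]
  exact ⟨fun h => ⟨h.1, hV h.1, h.2⟩, fun h => ⟨h.1, h.2.2⟩⟩

/-- New columns do not decrease the number of distinct rows. -/
theorem ncard_rowOf_mono (hR : R.Finite) (hV : V ⊆ V') :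
    (rowOf V '' R).ncard ≤ (rowOf V' '' R).ncard := by
  rw [rowOf_image_of_subset hV]
  exact Set.ncard_image_le (hR.image _)

/-- If new columns do not increase the number of distinct rows, then equal rows remain equal. -/
theorem rowLE_of_ncard_rowOf_le (hR : R.Finite) (hV : V ⊆ V')
    (h : (rowOf V' '' R).ncard ≤ (rowOf V '' R).ncard) (hK : K ∈ R) (hK' : K' ∈ R)
    (h₁ : RowLE V K K') (h₂ : RowLE V K' K) : RowLE V' K K' := by
  have hinj := Set.injOn_of_ncard_image_eq (f := fun r => {v | v ∈ V ∧ v ∈ r})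
    (s := rowOf V' '' R)
    (by rw [← rowOf_image_of_subset hV]; exact le_antisymm (ncard_rowOf_mono hR hV) h)
    (hR.image _)
  have hr : ∀ K : Language α, {v | v ∈ V ∧ v ∈ rowOf V' K} = rowOf V K := fun K => by
    ext v
    simp only [rowOf, Set.mem_ofPred_eq]
    exact ⟨fun h => ⟨h.1, h.2.2⟩, fun h => ⟨h.1, hV h.1, h.2⟩⟩
  refine (rowOf_eq_iff.1 (hinj (Set.mem_image_of_mem _ hK) (Set.mem_image_of_mem _ hK') ?_)).1
  simp only [hr]
  exact rowOf_eq_iff.2 ⟨h₁, h₂⟩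

/-- The old witness still works: a row strictly below over `V'` is strictly below over `V`, since
otherwise two rows equal over `V` would have been split and the number of rows would have grown. -/
theorem primeRows_subset_of_ncard_rowOf_le (hR : R.Finite) (hV : V ⊆ V')
    (h : (rowOf V' '' R).ncard ≤ (rowOf V '' R).ncard) : primeRows R V ⊆ primeRows R V' := by
  rintro K ⟨hK, v, hv, hvK, hmin⟩
  refine ⟨hK, v, hV hv, hvK, fun K' hK' h₁ h₂ => hmin K' hK' (h₁.anti hV) fun h₃ => h₂ ?_⟩
  exact rowLE_of_ncard_rowOf_le hR hV h hK hK' h₃ (h₁.anti hV)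

/-- New columns do not decrease the potential, and leave the order of the rows and the primes
unchanged if they do not increase it. -/
theorem potential_col {n k : ℕ} (hR : R.Finite) (hn : R.ncard ≤ n) (hV : V ⊆ V') :
    potential n k R V ≤ potential n k R V' ∧
      (potential n k R V' ≤ potential n k R V →
        (∀ K ∈ R, ∀ K' ∈ R, RowLE V K K' → RowLE V' K K') ∧
          primeRows R V' = primeRows R V) := by
  have h₁ : (sepPairs R V).ncard ≤ (sepPairs R V').ncard :=
    Set.ncard_le_ncard (sepPairs_mono subset_rfl hV) (finite_sepPairs hR)
  have h₂ := ncard_rowOf_mono hR hV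
  have h₃ : (primeRows R V).ncard ≤ n := (Set.ncard_le_ncard primeRows_subset hR).trans hn
  rcases h₂.lt_or_eq with hlt | heq
  · have : potential n k R V < potential n k R V' := by
      unfold potential
      nlinarith
    exact ⟨this.le, fun h => absurd h (not_le.2 this)⟩
  · have hP := primeRows_subset_of_ncard_rowOf_le hR hV heq.ge
    have h₄ := Set.ncard_le_ncard hP (hR.subset primeRows_subset)
    unfold potential
    rw [← heq]
    -- All summands are now monotone, so equal sums force equality of each, and nested finite sets
    -- of equal size coincide.
    refine ⟨by omega, fun h => ⟨fun K hK K' hK' hle => ?_, ?_⟩⟩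
    · by_contra hne
      have := Set.eq_of_subset_of_ncard_le (sepPairs_mono (R := R) subset_rfl hV) (by omega)
        (finite_sepPairs hR)
      have hmem : (K, K') ∈ sepPairs R V' := ⟨hK, hK', hne⟩
      rw [← this] at hmem
      exact hmem.2.2 hle
    · exact (Set.eq_of_subset_of_ncard_le hP (by omega) (hR.subset primeRows_subset)).symm

/-- New rows increase the potential. -/
theorem potential_row {n k : ℕ} (hR' : R'.Finite) (hn : R'.ncard ≤ n) (hR : R ⊆ R') :
    potential n k R V < potential n (k + 1) R' V := by
  have h₁ : (sepPairs R V).ncard ≤ (sepPairs R' V).ncard :=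
    Set.ncard_le_ncard (sepPairs_mono hR subset_rfl) (finite_sepPairs hR')
  have h₂ : (rowOf V '' R).ncard ≤ (rowOf V '' R').ncard :=
    Set.ncard_le_ncard (Set.image_mono hR) (hR'.image _)
  have h₃ : (primeRows R V).ncard ≤ n :=
    (Set.ncard_le_ncard (primeRows_subset.trans hR) hR').trans hn
  -- If new residuals appear, their weight pays for lost primes. Otherwise `R` is unchanged, and the
  -- gain is the additional upper row.
  rcases (Set.ncard_le_ncard hR hR').lt_or_eq with hlt | heq
  · unfold potential
    nlinarith
  · obtain rfl := Set.eq_of_subset_of_ncard_le hR heq.ge hR'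
    unfold potential
    omega

end Abstract

/-! ### Query programs -/

section Programs

variable {α : Type}

theorem Prog.exec_bind {β γ : Type} {L : Language α} (Te : Teacher L) (p : Prog α β)
    (f : β → Prog α γ) (t : Transcript α) :
    (p.bind f).exec Te t = (f (p.exec Te t).1).exec Te (p.exec Te t).2 := by
  induction p generalizing t with
  | ret b => rfl
  | memberQ w k ih => exact ih _ _
  | equivQ H k ih => exact ih _ _

variable [FinEnum α]

/-- The answer for `w` is stored. -/
def Known (T : Memo α) (w : List α) : Prop := (T.lookup w).isSome = true

/-- The stored answers are correct, and none is stored twice. -/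
structure Memo.Valid (L : Language α) (T : Memo α) : Prop where
  sound : ∀ w b, T.lookup w = some b → (b = true ↔ w ∈ L)
  nodup : (T.map Prod.fst).Nodup

theorem Memo.Valid.val_iff {L : Language α} {T : Memo α} (hT : T.Valid L) {w : List α}
    (hw : Known T w) : val T w = true ↔ w ∈ L := by
  obtain ⟨b, hb⟩ := Option.isSome_iff_exists.1 hw
  rw [← hT.sound w b hb, val, hb]
  cases b <;> decide

theorem known_cons {T : Memo α} {w x : List α} {b : Bool} :
    Known ((w, b) :: T) x ↔ x = w ∨ Known T x := by
  unfold Known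
  rw [List.lookup_cons]
  by_cases h : x = w
  · simp [h]
  · have : (x == w) = false := by simpa using h
    simp [this, h]

theorem known_iff_mem {T : Memo α} {x : List α} : Known T x ↔ x ∈ T.map Prod.fst := by
  induction T with
  | nil => simp [Known]
  | cons e T ih =>
    obtain ⟨w, b⟩ := e
    rw [known_cons, ih]
    simp

theorem Memo.Valid.cons {L : Language α} {T : Memo α} (hT : T.Valid L) {w : List α} {b : Bool}
    (hw : ¬ Known T w) (hb : b = true ↔ w ∈ L) : Memo.Valid L ((w, b) :: T) where
  sound x c h := by
    rw [List.lookup_cons] at h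
    by_cases hx : x = w
    · subst hx
      simp only [beq_self_eq_true, Option.some.injEq] at h
      rw [← h, hb]
    · have : (x == w) = false := by simpa using hx
      rw [this] at h
      exact hT.sound x c h
  nodup := by
    rw [List.map_cons, List.nodup_cons]
    exact ⟨fun h => hw (known_iff_mem.2 h), hT.nodup⟩

/-- `(T', t')` is obtained from the memory `T` and the transcript `t` by at most `c` MQs, on
strings that satisfy `p`. -/
structure Asks (L : Language α) (p : List α → Prop) (T : Memo α) (t : Transcript α) (T' : Memo α)
    (t' : Transcript α) (c : ℕ) : Prop where
  valid : T.Valid L → T'.Valid L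
  numMQ_add : numMQ t' + T.length = numMQ t + T'.length
  numEQ_eq : numEQ t' = numEQ t
  maxCex_eq : maxCex t' = maxCex t
  new : ∃ E : Memo α, T' = E ++ T ∧ E.length ≤ c ∧ ∀ e ∈ E, p e.1

variable {L : Language α} {p : List α → Prop}

theorem Asks.refl (L : Language α) (p : List α → Prop) (T : Memo α) (t : Transcript α) :
    Asks L p T t T t 0 :=
  ⟨id, rfl, rfl, rfl, [], rfl, le_rfl, by simp⟩

theorem Asks.mono {T T' : Memo α} {t t' : Transcript α} {c c' : ℕ} {p' : List α → Prop}
    (h : Asks L p T t T' t' c) (hc : c ≤ c') (hp : ∀ w, p w → p' w) : Asks L p' T t T' t' c' := by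
  obtain ⟨E, h₁, h₂, h₃⟩ := h.new
  exact ⟨h.valid, h.numMQ_add, h.numEQ_eq, h.maxCex_eq, E, h₁, h₂.trans hc,
    fun e he => hp _ (h₃ e he)⟩

theorem Asks.trans {T₁ T₂ T₃ : Memo α} {t₁ t₂ t₃ : Transcript α} {c c' : ℕ}
    (h : Asks L p T₁ t₁ T₂ t₂ c) (h' : Asks L p T₂ t₂ T₃ t₃ c') :
    Asks L p T₁ t₁ T₃ t₃ (c + c') := by
  obtain ⟨E, h₁, h₂, h₃⟩ := h.new
  obtain ⟨E', h₁', h₂', h₃'⟩ := h'.new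
  refine ⟨fun hv => h'.valid (h.valid hv), ?_, h'.numEQ_eq.trans h.numEQ_eq,
    h'.maxCex_eq.trans h.maxCex_eq, E' ++ E, by rw [h₁', h₁, List.append_assoc], ?_, ?_⟩
  · have := h.numMQ_add
    have := h'.numMQ_add
    omega
  · rw [List.length_append]
    omega
  · intro e he
    rcases List.mem_append.1 he with he | he
    · exact h₃' e he
    · exact h₃ e he

theorem Asks.known {T T' : Memo α} {t t' : Transcript α} {c : ℕ} (h : Asks L p T t T' t' c)
    {w : List α} (hw : Known T w) : Known T' w := by
  obtain ⟨E, rfl, -⟩ := h.new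
  rw [known_iff_mem] at hw ⊢
  rw [List.map_append]
  exact List.mem_append_right _ hw

/-- Only unknown answers are asked for. -/
theorem exec_askAll (Te : Teacher L) (ws : List (List α)) (T : Memo α) (t : Transcript α) :
    ∃ T' t', (askAll ws T).exec Te t = (T', t') ∧ Asks L (· ∈ ws) T t T' t' ws.length ∧
      (∀ w ∈ ws, Known T' w) ∧ ((∀ w ∈ ws, Known T w) → T' = T ∧ t' = t) := by
  classical
  induction ws generalizing T t with
  | nil => exact ⟨T, t, rfl, .refl L _ T t, by simp, fun _ => ⟨rfl, rfl⟩⟩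
  | cons w ws ih =>
    by_cases hw : Known T w
    · obtain ⟨T', t', h₁, h₂, h₃, h₄⟩ := ih T t
      refine ⟨T', t', ?_, h₂.mono (by simp) (by simp +contextual), ?_, fun h => h₄ fun x hx =>
        h x (List.mem_cons_of_mem _ hx)⟩
      · rw [askAll, if_pos (show _ = true from hw), h₁]
      · intro x hx
        rcases List.mem_cons.1 hx with rfl | hx
        · exact h₂.known hw
        · exact h₃ x hx
    · obtain ⟨T', t', h₁, h₂, h₃, -⟩ :=
        ih ((w, decide (w ∈ L)) :: T) (.member w (decide (w ∈ L)) :: t)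
      have hs : Asks L (· ∈ w :: ws) T t ((w, decide (w ∈ L)) :: T)
          (.member w (decide (w ∈ L)) :: t) 1 :=
        ⟨fun hT => hT.cons hw (by simp), by simp only [numMQ, List.length_cons]; omega, rfl, rfl,
          [(w, decide (w ∈ L))], rfl, le_rfl, by simp⟩
      refine ⟨T', t', ?_, (hs.trans (h₂.mono le_rfl (by simp +contextual))).mono
        (by rw [List.length_cons]; omega) fun _ => id, ?_, fun h =>
          absurd (h w List.mem_cons_self) hw⟩
      · rw [askAll, if_neg (show ¬ _ = true from hw), Prog.exec, h₁]
      · intro x hx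
        rcases List.mem_cons.1 hx with rfl | hx
        · exact h₂.known (known_cons.2 (Or.inl rfl))
        · exact h₃ x hx

/-- Binary search finds a change of the test, with about `k log (j - c)` MQs if those for tests
at arguments up to `c` are known, and at most `k` are needed for each test. -/
theorem exec_bsearch (Te : Teacher L) {ws : ℕ → List (List α)} {test : Memo α → ℕ → Bool}
    {P : ℕ → Prop} {T₀ : Memo α} {k c : ℕ} (hk : ∀ i, (ws i).length ≤ k)
    -- Tests have to be correct only for memories that extend `T₀`, because they may refer to
    -- answers stored before the search.
    (htest : ∀ T i, T.Valid L → (∀ w, Known T₀ w → Known T w) → (∀ w ∈ ws i, Known T w) →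
      (test T i = true ↔ P i))
    (hc : ∀ i ≤ c, ∀ w ∈ ws i, Known T₀ w) (i j : ℕ) (T : Memo α) (t : Transcript α)
    (hT : T.Valid L) (hT₀ : ∀ w, Known T₀ w → Known T w) (hij : i < j) (hi : ¬ P i) (hj : P j) :
    ∃ r T' t', (bsearch ws test i j T).exec Te t = ((r, T'), t') ∧ i ≤ r ∧ r < j ∧
      ¬ P r ∧ P (r + 1) ∧
      Asks L (fun _ => True) T t T' t'
        (k * (Nat.clog 2 (j - max i c) + if i < c then 1 else 0)) := by
  induction h : j - i using Nat.strong_induction_on generalizing i j T t with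
  | _ d ih =>
  rw [bsearch]
  by_cases hle : j ≤ i + 1
  · rw [if_pos hle]
    obtain rfl : j = i + 1 := by omega
    exact ⟨i, T, t, rfl, le_rfl, hij, hi, hj, (Asks.refl L _ T t).mono (Nat.zero_le _) fun _ => id⟩
  rw [if_neg hle]
  set m := (i + j) / 2 with hm
  obtain ⟨T₁, t₁, h₁, h₂, h₃, h₄⟩ := exec_askAll Te (ws m) T t
  have hT₁ := h₂.valid hT
  have hT₀₁ : ∀ w, Known T₀ w → Known T₁ w := fun w hw => h₂.known (hT₀ w hw)
  have hP := htest T₁ m hT₁ hT₀₁ h₃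
  have hs : Asks L (fun _ => True) T t T₁ t₁ (if m ≤ c then 0 else k) := by
    split_ifs with hmc
    · obtain ⟨rfl, rfl⟩ := h₄ fun w hw => hT₀ w (hc m hmc w hw)
      exact .refl _ _ _ _
    · exact h₂.mono (hk m) fun _ _ => trivial
  -- Halving the unknown part of the interval lowers the binary logarithm by one, which pays for the
  -- `k` MQs of the test.
  have hclog : ∀ x y : ℕ, x ≤ (y + 1) / 2 → 2 ≤ y → Nat.clog 2 x + 1 ≤ Nat.clog 2 y := by
    intro x y hxy hy
    rw [Nat.clog_of_two_le one_lt_two hy]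
    exact Nat.add_le_add_right (Nat.clog_mono_right 2 (by omega)) 1
  by_cases hPm : P m
  · obtain ⟨r, T', t', h₅, h₆, h₇, h₈, h₉, h₁₀⟩ :=
      ih (m - i) (by omega) i m T₁ t₁ hT₁ hT₀₁ (by omega) hi hPm rfl
    refine ⟨r, T', t', ?_, h₆, by omega, h₈, h₉, (hs.trans h₁₀).mono ?_ fun _ => id⟩
    · rw [Prog.exec_bind, h₁]
      simp only [hP.2 hPm, if_true]
      exact h₅
    · by_cases hmc : m ≤ c
      · rw [if_pos hmc, Nat.zero_add]
        exact Nat.mul_le_mul_left _ (Nat.add_le_add_right (Nat.clog_mono_right 2 (by omega)) _)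
      · rw [if_neg hmc]
        have := hclog (m - max i c) (j - max i c) (by omega) (by omega)
        calc k + k * (Nat.clog 2 (m - max i c) + if i < c then 1 else 0)
            = k * (Nat.clog 2 (m - max i c) + 1 + if i < c then 1 else 0) := by ring
          _ ≤ _ := Nat.mul_le_mul_left _ (Nat.add_le_add_right this _)
  · obtain ⟨r, T', t', h₅, h₆, h₇, h₈, h₉, h₁₀⟩ :=
      ih (j - m) (by omega) m j T₁ t₁ hT₁ hT₀₁ (by omega) hPm hj rfl
    refine ⟨r, T', t', ?_, by omega, h₇, h₈, h₉, (hs.trans h₁₀).mono ?_ fun _ => id⟩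
    · rw [Prog.exec_bind, h₁]
      have : test T₁ m = false := Bool.eq_false_iff.2 fun h => hPm (hP.1 h)
      simp only [this, Bool.false_eq_true, if_false]
      exact h₅
    · by_cases hmc : m ≤ c
      · rw [if_pos hmc, Nat.zero_add]
        by_cases hic : i < c
        · rw [if_pos hic]
          refine Nat.mul_le_mul_left _ (Nat.add_le_add (Nat.clog_mono_right 2 (by omega)) ?_)
          split_ifs <;> omega
        · omega
      · rw [if_neg hmc, if_neg (show ¬ m < c by omega), Nat.add_zero]
        by_cases hic : i < c
        -- Here the left end jumps from below `c` to above it, and the part beyond `c` need not have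
        -- been halved. This happens at most once, and the additional 1 in the bound pays for it.
        · rw [if_pos hic, mul_add, mul_one, add_comm]
          exact Nat.add_le_add_right
            (Nat.mul_le_mul_left _ (Nat.clog_mono_right 2 (by omega))) _
        · rw [if_neg hic, Nat.add_zero]
          have := hclog (j - max m c) (j - max i c) (by omega) (by omega)
          calc k + k * Nat.clog 2 (j - max m c) = k * (Nat.clog 2 (j - max m c) + 1) := by ring
            _ ≤ _ := Nat.mul_le_mul_left _ this

end Programs

/-! ### Observation tables -/

namespace Obs

variable {α : Type} [FinEnum α]

theorem mem_lower {S : Obs α} {x : List α} : x ∈ S.lower ↔ ∃ u ∈ S.U, ∃ a, x = u ++ [a] := by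
  simp [lower, eq_comm]

theorem mem_rows {S : Obs α} {x : List α} :
    x ∈ S.rows ↔ x ∈ S.U ∨ ∃ u ∈ S.U, ∃ a, x = u ++ [a] := by
  rw [rows, List.mem_append, mem_lower]

theorem mem_rows_of_mem {S : Obs α} {x : List α} (h : x ∈ S.U) : x ∈ S.rows :=
  mem_rows.2 (Or.inl h)

theorem append_mem_rows {S : Obs α} {x : List α} (h : x ∈ S.U) (a : α) : x ++ [a] ∈ S.rows :=
  mem_rows.2 (Or.inr ⟨x, h, a, rfl⟩)

theorem mem_cells {S : Obs α} {w : List α} :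
    w ∈ S.cells ↔ ∃ x ∈ S.rows, ∃ v ∈ S.V, w = x ++ v := by
  simp [cells, eq_comm]

/-- The residual languages of the rows. -/
def res (L : Language α) (S : Obs α) : Set (Language α) := L.leftQuotient '' {x | x ∈ S.rows}

/-- The set of columns. -/
def cols (S : Obs α) : Set (List α) := {v | v ∈ S.V}

theorem mem_res {L : Language α} {S : Obs α} {x : List α} (h : x ∈ S.rows) :
    L.leftQuotient x ∈ S.res L := ⟨x, h, rfl⟩

/-- The memory contains the correct answers for all cells. -/
structure Filled (L : Language α) (S : Obs α) : Prop where
  valid : S.T.Valid L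
  known : ∀ w ∈ S.cells, Known S.T w

/-- Row and column strings include the empty word, and upper rows are closed under prefixes. -/
structure Proper (S : Obs α) : Prop where
  nil_mem_U : [] ∈ S.U
  nil_mem_V : [] ∈ S.V
  prefix_mem : ∀ u a, u ++ [a] ∈ S.U → u ∈ S.U

/-- Prime rows occur as upper rows. -/
def Closed (L : Language α) (S : Obs α) : Prop :=
  ∀ x ∈ S.rows, L.leftQuotient x ∈ primeRows (S.res L) S.cols →
    ∃ u ∈ S.U, RowLE S.cols (L.leftQuotient x) (L.leftQuotient u) ∧
      RowLE S.cols (L.leftQuotient u) (L.leftQuotient x)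

/-- Inclusions of upper rows persist after extension by a letter. -/
def Consistent (L : Language α) (S : Obs α) : Prop :=
  ∀ u ∈ S.U, ∀ u' ∈ S.U, RowLE S.cols (L.leftQuotient u) (L.leftQuotient u') → ∀ a,
    RowLE S.cols (L.leftQuotient (u ++ [a])) (L.leftQuotient (u' ++ [a]))

variable {L : Language α} {S : Obs α}

namespace Filled

variable (hS : S.Filled L)
include hS

theorem val_iff {x v : List α} (hx : x ∈ S.rows) (hv : v ∈ S.V) :
    val S.T (x ++ v) = true ↔ x ++ v ∈ L :=
  hS.valid.val_iff (hS.known _ (mem_cells.2 ⟨x, hx, v, hv, rfl⟩))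

theorem rowLe_iff {x y : List α} (hx : x ∈ S.rows) (hy : y ∈ S.rows) :
    S.rowLe x y = true ↔ RowLE S.cols (L.leftQuotient x) (L.leftQuotient y) := by
  simp only [rowLe, List.all_eq_true, RowLE, cols, Set.mem_ofPred_eq, Language.mem_leftQuotient]
  refine forall₂_congr fun v hv => ?_
  rw [← hS.val_iff hx hv, ← hS.val_iff hy hv]
  cases val S.T (x ++ v) <;> simp

theorem isPrime_iff {x : List α} (hx : x ∈ S.rows) :
    S.isPrime x = true ↔ L.leftQuotient x ∈ primeRows (S.res L) S.cols := by
  simp only [isPrime, List.any_eq_true, Bool.and_eq_true, List.all_eq_true, primeRows,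
    Set.mem_ofPred_eq, mem_res hx, true_and]
  refine exists_congr fun v => and_congr_right fun hv => ?_
  rw [hS.val_iff hx hv, Language.mem_leftQuotient]
  refine and_congr_right fun _ => ?_
  simp only [res, Set.forall_mem_image]
  refine forall₂_congr fun y hy => ?_
  rw [← hS.rowLe_iff hx hy, ← hS.rowLe_iff hy hx, Language.mem_leftQuotient, ← hS.val_iff hy hv]
  cases S.rowLe x y <;> cases S.rowLe y x <;> simp

theorem mem_states {q : List α} :
    q ∈ S.states ↔ q ∈ S.U ∧ L.leftQuotient q ∈ primeRows (S.res L) S.cols := by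
  rw [states, List.mem_filter]
  exact and_congr_right fun h => hS.isPrime_iff (mem_rows_of_mem h)

theorem of_unclosed_some {x : List α} (h : S.unclosed = some x) : x ∈ S.lower ∧
    ∀ u ∈ S.U, rowOf S.cols (L.leftQuotient u) ≠ rowOf S.cols (L.leftQuotient x) := by
  have hx := List.mem_of_find?_eq_some h
  have hp := List.find?_some h
  simp only [Bool.and_eq_true, List.all_eq_true, Bool.not_eq_true', Bool.and_eq_false_iff] at hp
  refine ⟨hx, fun u hu he => ?_⟩
  obtain ⟨h₁, h₂⟩ := rowOf_eq_iff.1 he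
  have hxr : x ∈ S.rows := List.mem_append_right _ hx
  rw [← hS.rowLe_iff (mem_rows_of_mem hu) hxr] at h₁
  rw [← hS.rowLe_iff hxr (mem_rows_of_mem hu)] at h₂
  simpa [h₁, h₂] using hp.2 u hu

theorem closed (h : S.unclosed = none) : S.Closed L := by
  intro x hx hp
  rcases List.mem_append.1 hx with hU | hl
  · exact ⟨x, hU, .refl _ _, .refl _ _⟩
  · have := List.find?_eq_none.1 h x hl
    simp only [Bool.and_eq_true, not_and, List.all_eq_true, not_forall, Bool.not_eq_true',
      Bool.not_eq_false, exists_prop] at this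
    obtain ⟨u, hu, h₁, h₂⟩ := this ((hS.isPrime_iff hx).2 hp)
    exact ⟨u, hu, (hS.rowLe_iff hx (mem_rows_of_mem hu)).1 h₁,
      (hS.rowLe_iff (mem_rows_of_mem hu) hx).1 h₂⟩

omit hS in
theorem mem_inconsistent_iff {w : List α} :
    w ∈ (S.U.flatMap fun u => S.U.flatMap fun u' => (FinEnum.toList α).flatMap fun a =>
      (S.V.filter fun v => S.rowLe u u' && val S.T (u ++ [a] ++ v) &&
        !val S.T (u' ++ [a] ++ v)).map fun v => a :: v) ↔
    ∃ u ∈ S.U, ∃ u' ∈ S.U, ∃ a, ∃ v ∈ S.V, S.rowLe u u' = true ∧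
      val S.T (u ++ [a] ++ v) = true ∧ val S.T (u' ++ [a] ++ v) = false ∧ w = a :: v := by
  simp only [List.mem_flatMap, List.mem_map, List.mem_filter, FinEnum.mem_toList, true_and,
    Bool.and_eq_true, Bool.not_eq_true']
  constructor
  · rintro ⟨u, hu, u', hu', a, v, ⟨hv, ⟨h₁, h₂⟩, h₃⟩, rfl⟩
    exact ⟨u, hu, u', hu', a, v, hv, h₁, h₂, h₃, rfl⟩
  · rintro ⟨u, hu, u', hu', a, v, hv, h₁, h₂, h₃, rfl⟩
    exact ⟨u, hu, u', hu', a, v, ⟨hv, ⟨h₁, h₂⟩, h₃⟩, rfl⟩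

theorem of_inconsistent_some {w : List α} (h : S.inconsistent = some w) :
    ∃ u ∈ S.U, ∃ u' ∈ S.U, ∃ a, ∃ v ∈ S.V, w = a :: v ∧
      RowLE S.cols (L.leftQuotient u) (L.leftQuotient u') ∧ u ++ w ∈ L ∧ u' ++ w ∉ L := by
  obtain ⟨u, hu, u', hu', a, v, hv, h₁, h₂, h₃, rfl⟩ :=
    mem_inconsistent_iff.1 (List.mem_of_mem_head? (Option.mem_def.2 h))
  refine ⟨u, hu, u', hu', a, v, hv, rfl,
    (hS.rowLe_iff (mem_rows_of_mem hu) (mem_rows_of_mem hu')).1 h₁, ?_, ?_⟩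
  · rw [hS.val_iff (append_mem_rows hu a) hv] at h₂
    simpa using h₂
  · rw [← Bool.not_eq_true, hS.val_iff (append_mem_rows hu' a) hv] at h₃
    simpa using h₃

theorem consistent (h : S.inconsistent = none) : S.Consistent L := by
  intro u hu u' hu' hle a v hv hmem
  by_contra hmem'
  rw [inconsistent, List.head?_eq_none_iff] at h
  have := mem_inconsistent_iff.2 ⟨u, hu, u', hu', a, v, hv,
    (hS.rowLe_iff (mem_rows_of_mem hu) (mem_rows_of_mem hu')).2 hle,
    (hS.val_iff (append_mem_rows hu a) hv).2 hmem,
    Bool.eq_false_iff.2 fun h => hmem' ((hS.val_iff (append_mem_rows hu' a) hv).1 h), rfl⟩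
  rw [h] at this
  exact absurd this List.not_mem_nil

end Filled

theorem mem_of_badColumn_some {v : List α} (h : S.badColumn = some v) :
    v ∈ S.V ∧ S.agrees S.T v = false := by
  have hp := List.find?_some h
  simp only [Bool.and_eq_true, Bool.not_eq_true'] at hp
  exact ⟨List.mem_of_find?_eq_some h, hp.1⟩

/-- If there were bad columns, one of minimal length would pass the test of the search. -/
theorem agrees_of_badColumn_none (h : S.badColumn = none) : ∀ v ∈ S.V, S.agrees S.T v = true := by
  by_contra! hc
  obtain ⟨v₀, hv₀, hb₀⟩ := hc
  obtain ⟨v, ⟨hv, hb⟩, hmin⟩ := Set.exists_min_image {v | v ∈ S.V ∧ S.agrees S.T v ≠ true}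
    List.length (S.V.finite_toSet.subset fun _ h => h.1) ⟨v₀, hv₀, hb₀⟩
  refine List.find?_eq_none.1 h v hv ?_
  simp only [Bool.and_eq_true, Bool.not_eq_true', List.all_eq_true, Bool.or_eq_true,
    decide_eq_true_eq]
  refine ⟨Bool.eq_false_iff.2 hb, fun v' hv' => ?_⟩
  by_cases hb' : S.agrees S.T v' = true
  · exact Or.inl hb'
  · exact Or.inr (hmin v' ⟨hv', hb'⟩)

theorem agrees_iff {T : Memo α} {s : List α} (hT : T.Valid L)
    (h : ∀ q ∈ S.states, Known T (q ++ s)) :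
    S.agrees T s = true ↔ ∀ q ∈ S.states, (q ++ s ∈ L ↔ S.accFrom q s = true) := by
  simp only [agrees, List.all_eq_true, beq_iff_eq]
  refine forall₂_congr fun q hq => ?_
  rw [← hT.val_iff (h q hq), Bool.eq_iff_iff]

/-! ### Runs and accepted words of the hypothesis automaton -/

theorem mem_stepSet {P : List (List α)} {a : α} {q' : List α} :
    q' ∈ S.stepSet P a ↔ q' ∈ S.states ∧ ∃ q ∈ P, S.rowLe q' (q ++ [a]) = true := by
  simp [stepSet]

theorem reach_append_singleton (P : List (List α)) (w : List α) (a : α) :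
    S.reach P (w ++ [a]) = S.stepSet (S.reach P w) a := by
  simp [reach]

theorem reach_subset_states {P : List (List α)} (hP : ∀ q ∈ P, q ∈ S.states) (w : List α) :
    ∀ q ∈ S.reach P w, q ∈ S.states := by
  induction w using List.reverseRecOn with
  | nil => exact hP
  | append_singleton w a =>
    intro q hq
    rw [reach_append_singleton] at hq
    exact (mem_stepSet.1 hq).1

theorem initial_subset_states : ∀ q ∈ S.initial, q ∈ S.states := fun _ h =>
  (List.mem_filter.1 h).1

theorem mem_initial {q : List α} : q ∈ S.initial ↔ q ∈ S.states ∧ S.rowLe q [] = true := by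
  rw [initial, List.mem_filter]

theorem mem_reach_iff {P : List (List α)} {w : List α} {q' : List α} :
    q' ∈ S.reach P w ↔ ∃ q ∈ P, q' ∈ S.reach [q] w := by
  induction w using List.reverseRecOn generalizing q' with
  | nil => simp [reach]
  | append_singleton w a ih =>
    simp only [reach_append_singleton, mem_stepSet]
    constructor
    · rintro ⟨h₁, q, h₂, h₃⟩
      obtain ⟨p, hp, h₄⟩ := ih.1 h₂
      exact ⟨p, hp, h₁, q, h₄, h₃⟩
    · rintro ⟨p, hp, h₁, q, h₄, h₃⟩
      exact ⟨h₁, q, ih.2 ⟨p, hp, h₄⟩, h₃⟩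

theorem reach_append (P : List (List α)) (w w' : List α) :
    S.reach P (w ++ w') = S.reach (S.reach P w) w' := by
  simp [reach]

theorem accFrom_iff {q w : List α} :
    S.accFrom q w = true ↔ ∃ q' ∈ S.reach [q] w, val S.T q' = true := by
  simp [accFrom]

theorem accFrom_nil (q : List α) : S.accFrom q [] = val S.T q := by
  simp [accFrom, reach]

theorem accFrom_cons {q w : List α} {a : α} :
    S.accFrom q (a :: w) = true ↔
      ∃ q' ∈ S.states, S.rowLe q' (q ++ [a]) = true ∧ S.accFrom q' w = true := by
  have : S.reach [q] (a :: w) = S.reach (S.stepSet [q] a) w := rfl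
  simp only [accFrom_iff]
  rw [this]
  constructor
  · rintro ⟨q'', h₁, h₂⟩
    obtain ⟨q', h₃, h₄⟩ := mem_reach_iff.1 h₁
    obtain ⟨h₅, p, h₆, h₇⟩ := mem_stepSet.1 h₃
    rw [List.mem_singleton] at h₆
    exact ⟨q', h₅, h₆ ▸ h₇, q'', h₄, h₂⟩
  · rintro ⟨q', h₁, h₂, q'', h₃, h₄⟩
    exact ⟨q'', mem_reach_iff.2 ⟨q', mem_stepSet.2 ⟨h₁, q, List.mem_singleton_self q, h₂⟩, h₃⟩, h₄⟩

/-- This links the automaton on indices with the sets of strings handled by the learner; different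
indices may a priori carry the same string, so membership is compared index by index. -/
theorem mem_evalFrom_hyp {A : Set (Fin S.hyp.size)} {P : List (List α)}
    (hP : ∀ q ∈ P, q ∈ S.states) (hA : ∀ i : Fin S.states.length, i ∈ A ↔ S.states[i] ∈ P)
    (w : List α) (i : Fin S.states.length) :
    i ∈ S.hyp.toNFA.evalFrom A w ↔ S.states[i] ∈ S.reach P w := by
  induction w generalizing A P with
  | nil => exact hA i
  | cons a w ih =>
    rw [NFA.evalFrom_cons]
    refine ih (P := S.stepSet P a) (fun q hq => (mem_stepSet.1 hq).1) fun j => ?_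
    rw [mem_stepSet]
    refine Iff.trans NFA.mem_stepSet ?_
    constructor
    · rintro ⟨k, hk, hjk⟩
      exact ⟨List.getElem_mem _, S.states[k], (hA k).1 hk, hjk⟩
    · rintro ⟨-, q, hq, hjq⟩
      obtain ⟨k, hk, rfl⟩ := List.getElem_of_mem (hP q hq)
      exact ⟨⟨k, hk⟩, (hA ⟨k, hk⟩).2 hq, hjq⟩

theorem mem_lang_hyp {w : List α} :
    w ∈ S.hyp.lang ↔ ∃ q ∈ S.reach S.initial w, val S.T q = true := by
  have h := mem_evalFrom_hyp (S := S) (A := S.hyp.toNFA.start) (P := S.initial)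
    initial_subset_states (fun i => by
      rw [mem_initial]
      exact ⟨fun h => ⟨List.getElem_mem _, h⟩, fun h => h.2⟩) w
  rw [FinNFA.lang, NFA.mem_accepts]
  constructor
  · rintro ⟨i, hi, hw⟩
    exact ⟨_, (h i).1 hw, hi⟩
  · rintro ⟨q, hq, hv⟩
    obtain ⟨k, hk, rfl⟩ := List.getElem_of_mem (reach_subset_states initial_subset_states w q hq)
    exact ⟨⟨k, hk⟩, hv, (h ⟨k, hk⟩).2 hq⟩

theorem mem_lang_hyp_append {w w' : List α} :
    w ++ w' ∈ S.hyp.lang ↔ ∃ q ∈ S.reach S.initial w, S.accFrom q w' = true := by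
  simp only [mem_lang_hyp, reach_append, accFrom_iff]
  constructor
  · rintro ⟨q', h₁, h₂⟩
    obtain ⟨q, h₃, h₄⟩ := mem_reach_iff.1 h₁
    exact ⟨q, h₃, q', h₄, h₂⟩
  · rintro ⟨q, h₃, q', h₄, h₂⟩
    exact ⟨q', mem_reach_iff.2 ⟨q, h₃, h₄⟩, h₂⟩

end Obs

namespace Obs

variable {α : Type} [FinEnum α] {L : Language α} {S : Obs α}

/-! ### Progress by new columns -/

theorem res_addCol (T : Memo α) (v : List α) : (S.addCol T v).res L = S.res L := rfl

omit [FinEnum α] in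
theorem cols_subset_addCol (T : Memo α) (v : List α) : S.cols ⊆ (S.addCol T v).cols :=
  fun _ h => List.mem_append_left _ h

omit [FinEnum α] in
theorem mem_cols_addCol (T : Memo α) (v : List α) : v ∈ (S.addCol T v).cols :=
  List.mem_append_right _ (List.mem_singleton_self v)

theorem res_subset (L : Language α) (S : Obs α) : S.res L ⊆ residuals L := by
  rintro _ ⟨x, -, rfl⟩
  exact ⟨x, rfl⟩

/-- In a closed table, each row is the union of the rows of the states included in it. This
remains true for additional columns that affect neither the order of the rows nor their
primality. -/
theorem Filled.mem_iff_exists_state (hS : S.Filled L) (hc : S.Closed L)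
    (hfin : (residuals L).Finite) {V : Set (List α)}
    (hle : ∀ K ∈ S.res L, ∀ K' ∈ S.res L, RowLE S.cols K K' → RowLE V K K')
    (hP : primeRows (S.res L) V = primeRows (S.res L) S.cols) {x v : List α} (hx : x ∈ S.rows)
    (hv : v ∈ V) (hV : S.cols ⊆ V) :
    x ++ v ∈ L ↔ ∃ q ∈ S.states, S.rowLe q x = true ∧ q ++ v ∈ L := by
  constructor
  -- A prime row for `V` containing `v` is also prime for the old columns. Closedness replaces it by
  -- an upper row equal on the old columns, and persistence of the order transfers `v` to that row.
  · intro h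
    obtain ⟨K, hK, hKx, hvK⟩ :=
      exists_primeRow (hfin.subset (S.res_subset L)) (mem_res hx) hv
        (show v ∈ L.leftQuotient x from h)
    rw [hP] at hK
    obtain ⟨y, hy, rfl⟩ := hK.1
    obtain ⟨u, hu, h₁, h₂⟩ := hc y hy hK
    have hur := mem_rows_of_mem hu
    refine ⟨u, hS.mem_states.2 ⟨hu, mem_res hur, ?_⟩, (hS.rowLe_iff hur hx).2
      (h₂.trans (hKx.anti hV)), hle _ hK.1 _ (mem_res hur) h₁ v hv hvK⟩
    -- Primality depends only on the row, so it passes from `y` to `u`.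
    obtain ⟨-, v', hv', hv'y, hmin⟩ := hK
    exact ⟨v', hv', h₁ v' hv' hv'y, fun K' hK' h₃ h₄ =>
      hmin K' hK' (h₃.trans h₂) fun h₅ => h₄ (h₂.trans h₅)⟩
  · rintro ⟨q, hq, h₁, h₂⟩
    have hqr := mem_rows_of_mem (List.mem_filter.1 hq).1
    exact hle _ (mem_res hqr) _ (mem_res hx) ((hS.rowLe_iff hqr hx).1 h₁) v hv h₂

/-- The potential of a table. -/
noncomputable def pot (L : Language α) (S : Obs α) : ℕ :=
  potential (residuals L).ncard S.U.length (S.res L) S.cols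

theorem pot_le (hfin : (residuals L).Finite) (hU : S.U.length ≤ (residuals L).ncard) :
    S.pot L ≤ 7 * (residuals L).ncard ^ 2 := by
  have hne : 0 < (residuals L).ncard :=
    (Set.ncard_pos hfin).2 ⟨L, [], Language.leftQuotient_nil L⟩
  exact potential_le (hfin.subset (S.res_subset L))
    (Set.ncard_le_ncard (S.res_subset L) hfin) hU hne

/-- A new column whose answers are not determined by the answers for the states increases the
potential. -/
theorem Filled.pot_lt_addCol (hS : S.Filled L) (hc : S.Closed L) (hfin : (residuals L).Finite)
    (T : Memo α) {v : List α}
    (h : ¬ ∀ x ∈ S.rows, (x ++ v ∈ L ↔ ∃ q ∈ S.states, S.rowLe q x = true ∧ q ++ v ∈ L)) :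
    S.pot L < (S.addCol T v).pot L := by
  by_contra hlt
  obtain ⟨-, h₂⟩ := potential_col (n := (residuals L).ncard) (k := S.U.length)
    (hfin.subset (S.res_subset L)) (Set.ncard_le_ncard (S.res_subset L) hfin)
    (cols_subset_addCol T v)
  obtain ⟨h₃, h₄⟩ := h₂ (not_lt.1 hlt)
  exact h fun x hx => hS.mem_iff_exists_state hc hfin h₃ h₄ hx (mem_cols_addCol T v)
    (cols_subset_addCol T v)

/-- The column breaks an inclusion of rows, so it adds a separated pair; this is the progress made
by a consistency step. -/
theorem pot_lt_addCol_of_rowLE (hfin : (residuals L).Finite) (T : Memo α) {v x y : List α}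
    (hx : x ∈ S.rows) (hy : y ∈ S.rows)
    (hle : RowLE S.cols (L.leftQuotient x) (L.leftQuotient y)) (hxv : x ++ v ∈ L)
    (hyv : y ++ v ∉ L) : S.pot L < (S.addCol T v).pot L := by
  by_contra hlt
  obtain ⟨-, h₂⟩ := potential_col (n := (residuals L).ncard) (k := S.U.length)
    (hfin.subset (S.res_subset L)) (Set.ncard_le_ncard (S.res_subset L) hfin)
    (cols_subset_addCol T v)
  exact hyv ((h₂ (not_lt.1 hlt)).1 _ (mem_res hx) _ (mem_res hy) hle v (mem_cols_addCol T v) hxv)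

theorem res_subset_addRow (T : Memo α) (x : List α) : S.res L ⊆ (S.addRow T x).res L := by
  refine Set.image_mono fun y hy => ?_
  rw [Set.mem_ofPred_eq, mem_rows] at hy ⊢
  rcases hy with hy | ⟨u, hu, a, rfl⟩
  · exact Or.inl (List.mem_append_left _ hy)
  · exact Or.inr ⟨u, List.mem_append_left _ hu, a, rfl⟩

theorem pot_lt_addRow (hfin : (residuals L).Finite) (T : Memo α) (x : List α) :
    S.pot L < (S.addRow T x).pot L := by
  have : (S.addRow T x).pot L =
      potential (residuals L).ncard (S.U.length + 1) ((S.addRow T x).res L) S.cols := by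
    simp [pot, addRow, cols]
  rw [this]
  exact potential_row (hfin.subset (res_subset L _))
    (Set.ncard_le_ncard (res_subset L _) hfin) (res_subset_addRow T x)

/-- The repair of a column makes progress. -/
theorem Filled.pot_lt_repair (hS : S.Filled L) (hc : S.Closed L) (hfin : (residuals L).Finite)
    (T : Memo α) {v : List α} {a : α}
    (hv : ∀ q ∈ S.states, (q ++ v ∈ L ↔ S.accFrom q v = true))
    (hav : ¬ ∀ q ∈ S.states, (q ++ a :: v ∈ L ↔ S.accFrom q (a :: v) = true)) :
    S.pot L < (S.addCol T v).pot L := by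
  refine hS.pot_lt_addCol hc hfin T fun h => hav fun q hq => ?_
  have hqa := append_mem_rows (S := S) (List.mem_filter.1 hq).1 a
  -- If the answers for `v` were determined by the states, correctness on `v` would propagate
  -- through one transition to `a v`.
  rw [accFrom_cons, List.append_cons, h _ hqa]
  exact exists_congr fun q' => and_congr_right fun hq' => and_congr_right fun _ => hv q' hq'

/-- A counterexample that is not explained by the initial states makes progress. -/
theorem Filled.pot_lt_initial (hS : S.Filled L) (hp : S.Proper) (hc : S.Closed L)
    (hfin : (residuals L).Finite) (T : Memo α) {w : List α}
    (h : ¬ ((∃ q ∈ S.initial, q ++ w ∈ L) ↔ w ∈ L)) : S.pot L < (S.addCol T w).pot L := by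
  refine hS.pot_lt_addCol hc hfin T fun h' => h ?_
  have := h' [] (mem_rows_of_mem hp.nil_mem_U)
  rw [List.nil_append] at this
  rw [this]
  simp only [mem_initial, and_assoc]

/-- The suffix found by the binary search on a counterexample makes progress. -/
theorem Filled.pot_lt_refine (hS : S.Filled L) (hc : S.Closed L) (hfin : (residuals L).Finite)
    (T : Memo α) {P : List (List α)} (hP : ∀ q ∈ P, q ∈ S.states) {v : List α} {a : α}
    (h : ¬ ((∃ q ∈ P, q ++ a :: v ∈ L) ↔ ∃ q ∈ S.stepSet P a, q ++ v ∈ L)) :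
    S.pot L < (S.addCol T v).pot L := by
  refine hS.pot_lt_addCol hc hfin T fun h' => h ?_
  simp only [mem_stepSet]
  constructor
  · rintro ⟨q, hq, hqv⟩
    rw [List.append_cons, h' _ (append_mem_rows (List.mem_filter.1 (hP q hq)).1 a)] at hqv
    obtain ⟨q', h₁, h₂, h₃⟩ := hqv
    exact ⟨q', ⟨h₁, q, hq, h₂⟩, h₃⟩
  · rintro ⟨q', ⟨h₁, q, hq, h₂⟩, h₃⟩
    refine ⟨q, hq, ?_⟩
    rw [List.append_cons, h' _ (append_mem_rows (List.mem_filter.1 (hP q hq)).1 a)]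
    exact ⟨q', h₁, h₂, h₃⟩

/-! ### Correct hypotheses -/

section Correct

variable (hS : S.Filled L) (hp : S.Proper) (hcs : S.Consistent L)
  (hgood : ∀ v ∈ S.V, ∀ q ∈ S.states, (q ++ v ∈ L ↔ S.accFrom q v = true))

-- By consistency, every successor of `q` is a successor of `q'`, so from the first letter on an
-- accepting run can be copied. For the empty word, the column `[]` decides.
include hS hp hcs in
theorem accFrom_mono {q q' : List α} (hq : q ∈ S.states) (hq' : q' ∈ S.states)
    (hle : RowLE S.cols (L.leftQuotient q) (L.leftQuotient q')) {w : List α}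
    (hw : S.accFrom q w = true) : S.accFrom q' w = true := by
  have hU := (List.mem_filter.1 hq).1
  have hU' := (List.mem_filter.1 hq').1
  cases w with
  | nil =>
    rw [accFrom_nil, ← List.append_nil q,
      hS.val_iff (mem_rows_of_mem hU) hp.nil_mem_V] at hw
    rw [accFrom_nil, ← List.append_nil q', hS.val_iff (mem_rows_of_mem hU') hp.nil_mem_V]
    exact hle [] hp.nil_mem_V hw
  | cons a w =>
    obtain ⟨p, hpst, h₁, h₂⟩ := accFrom_cons.1 hw
    refine accFrom_cons.2 ⟨p, hpst, ?_, h₂⟩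
    have hpU := mem_rows_of_mem (List.mem_filter.1 hpst).1
    rw [hS.rowLe_iff hpU (append_mem_rows hU a)] at h₁
    rw [hS.rowLe_iff hpU (append_mem_rows hU' a)]
    exact h₁.trans (hcs q hU q' hU' hle a)

-- Induction along the prefixes of `u`, which are upper row strings themselves, so consistency
-- applies at each letter.
include hS hp hcs in
theorem rowLE_of_mem_reach {u : List α} (hu : u ∈ S.U) {q : List α}
    (hq : q ∈ S.reach S.initial u) : RowLE S.cols (L.leftQuotient q) (L.leftQuotient u) := by
  induction u using List.reverseRecOn generalizing q with
  | nil =>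
    obtain ⟨h₁, h₂⟩ := mem_initial.1 hq
    exact (hS.rowLe_iff (mem_rows_of_mem (List.mem_filter.1 h₁).1) (mem_rows_of_mem hu)).1 h₂
  | append_singleton u a ih =>
    rw [reach_append_singleton] at hq
    obtain ⟨h₁, p, h₂, h₃⟩ := mem_stepSet.1 hq
    have hu' := hp.prefix_mem u a hu
    have hpU := (List.mem_filter.1 (reach_subset_states initial_subset_states u p h₂)).1
    rw [hS.rowLe_iff (mem_rows_of_mem (List.mem_filter.1 h₁).1) (append_mem_rows hpU a)] at h₃
    exact h₃.trans (hcs p hpU u hu' (ih hu' h₂) a)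

variable (hL : S.hyp.lang = L)

include hS hp hcs hgood hL in
/-- In an equivalent hypothesis, the states accept the residual languages. -/
theorem accFrom_iff_mem {q : List α} (hq : q ∈ S.states) (w : List α) :
    S.accFrom q w = true ↔ q ++ w ∈ L := by
  obtain ⟨hU, -, v, hv, hqv, hmin⟩ := hS.mem_states.1 hq
  have hmem : ∀ w, q ++ w ∈ L ↔ ∃ p ∈ S.reach S.initial q, S.accFrom p w = true := fun w => by
    rw [← mem_lang_hyp_append, hL]
  have hst := reach_subset_states (S := S) initial_subset_states q
  rw [hmem]
  constructor
  · intro hw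
    obtain ⟨p, hp₁, hp₂⟩ := (hmem v).1 hqv
    have hp₃ := hst p hp₁
    -- The column `v` witnesses that `q` is prime. The state `p` is reached by `q`, so its row is
    -- below that of `q`, and it accepts `v`; were the inclusion strict, this would contradict the
    -- choice of `v`.
    have hle : RowLE S.cols (L.leftQuotient q) (L.leftQuotient p) := by
      by_contra hne
      exact hmin _ (mem_res (mem_rows_of_mem (List.mem_filter.1 hp₃).1))
        (rowLE_of_mem_reach hS hp hcs hU hp₁) hne ((hgood v hv p hp₃).2 hp₂)
    exact ⟨p, hp₁, accFrom_mono hS hp hcs hq hp₃ hle hw⟩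
  · rintro ⟨p, hp₁, hp₂⟩
    exact accFrom_mono hS hp hcs (hst p hp₁) hq (rowLE_of_mem_reach hS hp hcs hU hp₁) hp₂

include hS hp hcs hgood hL

theorem leftQuotient_le_iff {q q' : List α} (hq : q ∈ S.states) (hq' : q' ∈ S.states) :
    L.leftQuotient q ≤ L.leftQuotient q' ↔
      RowLE S.cols (L.leftQuotient q) (L.leftQuotient q') := by
  refine ⟨fun h v _ hv => h hv, fun h w hw => ?_⟩
  exact (accFrom_iff_mem hS hp hcs hgood hL hq' w).1
    (accFrom_mono hS hp hcs hq hq' h ((accFrom_iff_mem hS hp hcs hgood hL hq w).2 hw))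

/-- Each residual language is the union of the residual languages of some states. -/
theorem exists_state_of_mem_residual {K : Language α} (hK : K ∈ residuals L) {w : List α}
    (hw : w ∈ K) : ∃ q ∈ S.states, L.leftQuotient q ≤ K ∧ w ∈ L.leftQuotient q := by
  obtain ⟨u, rfl⟩ := hK
  have hmem : ∀ w, w ∈ L.leftQuotient u ↔
      ∃ p ∈ S.reach S.initial u, S.accFrom p w = true := fun w => by
    rw [← mem_lang_hyp_append, hL, Language.mem_leftQuotient]
  have hst := reach_subset_states (S := S) initial_subset_states u
  obtain ⟨p, hp₁, hp₂⟩ := (hmem w).1 hw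
  refine ⟨p, hst p hp₁, fun w' hw' => (hmem w').2 ⟨p, hp₁, ?_⟩, ?_⟩
  · exact (accFrom_iff_mem hS hp hcs hgood hL (hst p hp₁) w').2 hw'
  · exact (accFrom_iff_mem hS hp hcs hgood hL (hst p hp₁) w).1 hp₂

/-- The witnessing column also works among all residuals: if a strictly smaller residual contained
it, so would a state below that residual, whose row would be strictly below that of `q`. -/
theorem leftQuotient_mem_primes {q : List α} (hq : q ∈ S.states) :
    L.leftQuotient q ∈ primes (residuals L) := by
  obtain ⟨hU, -, v, hv, hqv, hmin⟩ := hS.mem_states.1 hq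
  refine mem_primes_iff.2 ⟨⟨q, rfl⟩, v, hqv, fun K' hK' hlt hvK' => ?_⟩
  obtain ⟨p, hp₁, hp₂, hp₃⟩ := exists_state_of_mem_residual hS hp hcs hgood hL hK' hvK'
  refine hmin _ (mem_res (mem_rows_of_mem (List.mem_filter.1 hp₁).1))
    (fun v _ h => (hp₂.trans hlt.le) h) (fun hne => ?_) hp₃
  exact absurd ((leftQuotient_le_iff hS hp hcs hgood hL hq hp₁).2 hne)
    fun h => hlt.not_ge (h.trans hp₂)

/-- A prime contains a word that no strictly smaller residual contains, so a state below it whose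
residual contains this word has the whole prime as its residual. -/
theorem exists_state_of_mem_primes {K : Language α} (hK : K ∈ primes (residuals L)) :
    ∃ q ∈ S.states, L.leftQuotient q = K := by
  obtain ⟨hKr, w, hw, hmin⟩ := mem_primes_iff.1 hK
  obtain ⟨q, hq, h₁, h₂⟩ := exists_state_of_mem_residual hS hp hcs hgood hL hKr hw
  refine ⟨q, hq, h₁.eq_of_not_lt fun hlt => hmin _ ⟨q, rfl⟩ hlt h₂⟩

/-- An equivalent hypothesis is isomorphic to the canonical residual automaton. -/
theorem nonempty_iso_hyp
    (hU : S.U.Pairwise fun u u' =>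
      rowOf S.cols (L.leftQuotient u) ≠ rowOf S.cols (L.leftQuotient u')) :
    Nonempty (NFAIso S.hyp.toNFA (canonicalRFA L)) := by
  have hst : ∀ i : Fin S.states.length, S.states[i] ∈ S.states := fun i => List.getElem_mem _
  have hrow : ∀ i : Fin S.states.length, S.states[i] ∈ S.rows := fun i =>
    mem_rows_of_mem (List.mem_filter.1 (hst i)).1
  have hacc := fun i : Fin S.states.length =>
    accFrom_iff_mem hS hp hcs hgood hL (hst i)
  have hpw : S.states.Pairwise fun u u' =>
      rowOf S.cols (L.leftQuotient u) ≠ rowOf S.cols (L.leftQuotient u') :=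
    hU.sublist List.filter_sublist
  let f : Fin S.hyp.size → primes (residuals L) := fun i : Fin S.states.length =>
    ⟨L.leftQuotient S.states[i], leftQuotient_mem_primes hS hp hcs hgood hL (hst i)⟩
  have hf : Function.Bijective f := by
    constructor
    · intro (i : Fin S.states.length) (j : Fin S.states.length) hij
      have h := congrArg Subtype.val hij
      rw [List.pairwise_iff_getElem] at hpw
      rcases lt_trichotomy i.1 j.1 with hlt | heq | hlt
      · exact absurd (congrArg (rowOf S.cols) h) (hpw i j i.2 j.2 hlt)
      · exact Fin.ext heq
      · exact absurd (congrArg (rowOf S.cols) h.symm) (hpw j i j.2 i.2 hlt)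
    · rintro ⟨K, hK⟩
      obtain ⟨q, hq, rfl⟩ := exists_state_of_mem_primes hS hp hcs hgood hL hK
      obtain ⟨k, hk, rfl⟩ := List.getElem_of_mem hq
      exact ⟨(⟨k, hk⟩ : Fin S.states.length), rfl⟩
  refine ⟨⟨Equiv.ofBijective f hf, fun (i : Fin S.states.length) => ?_,
    fun (i : Fin S.states.length) => ?_,
    fun (i : Fin S.states.length) a (j : Fin S.states.length) => ?_⟩⟩
  · change L.leftQuotient S.states[i] ≤ L ↔ S.rowLe S.states[i] [] = true
    rw [hS.rowLe_iff (hrow i) (mem_rows_of_mem hp.nil_mem_U), Language.leftQuotient_nil]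
    -- An inclusion of rows makes `q` initial, so whatever `q` accepts lies in the language of the
    -- hypothesis, which is `L`.
    refine ⟨fun h v _ hv => h hv, fun h w hw => ?_⟩
    have := mem_lang_hyp_append (S := S) (w := []) (w' := w)
    rw [List.nil_append, hL] at this
    refine this.2 ⟨S.states[i], ?_, (hacc i w).2 hw⟩
    exact mem_initial.2 ⟨hst i, (hS.rowLe_iff (hrow i) (mem_rows_of_mem hp.nil_mem_U)).2 h⟩
  · change [] ∈ L.leftQuotient S.states[i] ↔ val S.T S.states[i] = true
    rw [Language.mem_leftQuotient, ← hS.val_iff (hrow i) hp.nil_mem_V, List.append_nil]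
  · change L.leftQuotient S.states[j] ≤ (L.leftQuotient S.states[i]).leftQuotient [a] ↔
      S.rowLe S.states[j] (S.states[i] ++ [a]) = true
    have hia := append_mem_rows (S := S) (List.mem_filter.1 (hst i)).1 a
    rw [← Language.leftQuotient_append, hS.rowLe_iff (hrow j) hia]
    -- An inclusion of rows is a transition, and a word accepted after it is accepted with the
    -- letter `a` in front.
    refine ⟨fun h v _ hv => h hv, fun h w hw => ?_⟩
    have := (hacc i (a :: w)).1 (accFrom_cons.2
      ⟨S.states[j], hst j, (hS.rowLe_iff (hrow j) hia).2 h, (hacc j w).2 hw⟩)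
    change S.states[i] ++ [a] ++ w ∈ L
    rw [List.append_assoc]
    exact this

end Correct

end Obs

/-! ### Counting queries: table bounds and the invariant of `binaryNLStar` -/

namespace Obs

variable {α : Type} [FinEnum α] {L : Language α} {S : Obs α}

/-- Bound for the number of MQs of a binary search, on strings outside the table. -/
def searchCost (n m : ℕ) : ℕ := n * (Nat.clog 2 m + 1) + 1

theorem searchCost_mono (n : ℕ) {m m' : ℕ} (h : m ≤ m') : searchCost n m ≤ searchCost n m' :=
  Nat.add_le_add_right
    (Nat.mul_le_mul_left _ (Nat.add_le_add_right (Nat.clog_mono_right 2 h) _)) _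

/-- The number of stored answers for strings outside the table. -/
def extra (S : Obs α) : ℕ := S.T.countP fun e => decide (e.1 ∉ S.cells)

/-- The upper rows are pairwise different. -/
def Distinct (L : Language α) (S : Obs α) : Prop :=
  S.U.Pairwise fun u u' => rowOf S.cols (L.leftQuotient u) ≠ rowOf S.cols (L.leftQuotient u')

omit [FinEnum α] in
theorem Distinct.length_le (h : S.Distinct L) (hfin : (residuals L).Finite) :
    S.U.length ≤ (residuals L).ncard := by
  have hnd : (S.U.map L.leftQuotient).Nodup := by
    rw [List.nodup_iff_pairwise_ne, List.pairwise_map]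
    exact h.imp fun h he => h (congrArg (rowOf S.cols) he)
  classical
  rw [← List.length_map (f := L.leftQuotient), ← List.toFinset_card_of_nodup hnd,
    ← Set.ncard_coe_finset]
  refine Set.ncard_le_ncard (fun K hK => ?_) hfin
  rw [List.coe_toFinset, Set.mem_ofPred_eq, List.mem_map] at hK
  obtain ⟨u, -, rfl⟩ := hK
  exact ⟨u, rfl⟩

omit [FinEnum α] in
theorem Distinct.of_subset {S' : Obs α} (h : S.Distinct L) (hU : S'.U = S.U)
    (hV : S.cols ⊆ S'.cols) : S'.Distinct L := by
  rw [Distinct, hU]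
  refine h.imp fun h he => h ?_
  obtain ⟨h₁, h₂⟩ := rowOf_eq_iff.1 he
  exact rowOf_eq_iff.2 ⟨h₁.anti hV, h₂.anti hV⟩

omit [FinEnum α] in
theorem Distinct.addRow (h : S.Distinct L) (T : Memo α) {x : List α}
    (hx : ∀ u ∈ S.U, rowOf S.cols (L.leftQuotient u) ≠ rowOf S.cols (L.leftQuotient x)) :
    (S.addRow T x).Distinct L := by
  refine List.pairwise_append.2 ⟨h, List.pairwise_singleton _ _, fun u hu y hy => ?_⟩
  rw [List.mem_singleton] at hy
  rw [hy]
  exact hx u hu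

omit [FinEnum α] in
theorem Proper.addCol (h : S.Proper) (T : Memo α) (v : List α) : (S.addCol T v).Proper :=
  ⟨h.nil_mem_U, List.mem_append_left _ h.nil_mem_V, h.prefix_mem⟩

theorem Proper.addRow (h : S.Proper) (T : Memo α) {x : List α} (hx : x ∈ S.lower) :
    (S.addRow T x).Proper := by
  refine ⟨List.mem_append_left _ h.nil_mem_U, h.nil_mem_V, fun u a hu => ?_⟩
  rcases List.mem_append.1 hu with hu | hu
  · exact List.mem_append_left _ (h.prefix_mem u a hu)
  · obtain ⟨u', hu', b, rfl⟩ := mem_lower.1 hx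
    rw [List.mem_singleton] at hu
    obtain ⟨rfl, -⟩ := List.append_inj' hu rfl
    exact List.mem_append_left _ hu'

theorem cells_subset {S' : Obs α} (hU : S.U ⊆ S'.U) (hV : S.V ⊆ S'.V) : S.cells ⊆ S'.cells := by
  intro w hw
  obtain ⟨x, hx, v, hv, rfl⟩ := mem_cells.1 hw
  refine mem_cells.2 ⟨x, ?_, v, hV hv, rfl⟩
  rcases mem_rows.1 hx with hx | ⟨u, hu, a, rfl⟩
  · exact mem_rows_of_mem (hU hx)
  · exact append_mem_rows (hU hu) a

/-- The set of cells only grows, so only newly stored answers can add to the count. -/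
theorem extra_le {S' : Obs α} (hU : S.U ⊆ S'.U) (hV : S.V ⊆ S'.V) {E : Memo α}
    (hT : S'.T = E ++ S.T) : S'.extra ≤ E.length + S.extra := by
  rw [extra, hT, List.countP_append]
  refine Nat.add_le_add List.countP_le_length (List.countP_mono_left fun e _ he => ?_)
  simp only [decide_eq_true_eq] at he ⊢
  exact fun h => he (cells_subset hU hV h)

/-- No string is stored twice, so the stored cells inject into the list of all cells. -/
theorem length_le_cells_add_extra (h : S.T.Valid L) : S.T.length ≤ S.cells.length + S.extra := by
  rw [List.length_eq_countP_add_countP (fun e : List α × Bool => decide (e.1 ∈ S.cells)), extra]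
  refine Nat.add_le_add ?_ (List.countP_mono_left fun e _ he => by simpa using he)
  rw [List.countP_eq_length_filter, ← List.length_map (f := Prod.fst)]
  refine (List.subperm_of_subset ((List.filter_sublist.map _).nodup h.nodup)
    fun w hw => ?_).length_le
  obtain ⟨e, he, rfl⟩ := List.mem_map.1 hw
  simpa using (List.mem_filter.1 he).2

theorem length_lower : S.lower.length = S.U.length * Fintype.card α := by
  have : (FinEnum.toList α).length = Fintype.card α := by
    rw [FinEnum.card_eq_fintypeCard.symm]
    simp [FinEnum.toList]
  simp [lower, List.length_flatMap, this]

theorem length_cells :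
    S.cells.length = S.U.length * (1 + Fintype.card α) * S.V.length := by
  simp [cells, List.length_flatMap, rows, length_lower]
  ring

/-- Bounds on a table and a transcript in terms of the progress `p` made so far and the cost `c`
of a search. -/
structure Bounds (L : Language α) (S : Obs α) (t : Transcript α) (p c : ℕ) : Prop where
  proper : S.Proper
  distinct : S.Distinct L
  valid : S.T.Valid L
  numMQ_eq : numMQ t = S.T.length
  numEQ_le : numEQ t ≤ p
  -- The 1 accounts for the initial column `[]`.
  length_V : S.V.length ≤ p + 1
  extra_le : S.extra ≤ p * c

/-- Filling asks only for cells, so it contributes nothing to `extra`. -/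
theorem Bounds.fill {t : Transcript α} {p c : ℕ} (h : S.Bounds L t p c) (Te : Teacher L) :
    ∃ T' t', (askAll S.cells S.T).exec Te t = (T', t') ∧ Bounds L ⟨S.U, S.V, T'⟩ t' p c ∧
      Filled L ⟨S.U, S.V, T'⟩ ∧ maxCex t' = maxCex t := by
  obtain ⟨T', t', h₁, h₂, h₃, -⟩ := exec_askAll Te S.cells S.T t
  refine ⟨T', t', h₁, ⟨⟨h.proper.1, h.proper.2, h.proper.3⟩, h.distinct, h₂.valid h.valid, ?_,
    h₂.numEQ_eq.trans_le h.numEQ_le, h.length_V, ?_⟩, ⟨h₂.valid h.valid, h₃⟩, h₂.maxCex_eq⟩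
  · have := h₂.numMQ_add
    have := h.numMQ_eq
    change _ = T'.length
    omega
  · refine le_trans ?_ h.extra_le
    obtain ⟨E, rfl, -, hE⟩ := h₂.new
    rw [extra, List.countP_append, List.countP_eq_zero.2, Nat.zero_add]
    · exact le_rfl
    · intro e he
      have : e.1 ∈ cells ⟨S.U, S.V, E ++ S.T⟩ := hE e he
      simpa using this

theorem Bounds.addRow {t : Transcript α} {p p' c : ℕ} (h : S.Bounds L t p c) (hp : p < p')
    {x : List α} (hx : x ∈ S.lower)
    (hne : ∀ u ∈ S.U, rowOf S.cols (L.leftQuotient u) ≠ rowOf S.cols (L.leftQuotient x)) :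
    (S.addRow S.T x).Bounds L t p' c := by
  refine ⟨h.proper.addRow _ hx, h.distinct.addRow _ hne, h.valid, h.numMQ_eq,
    h.numEQ_le.trans hp.le, h.length_V.trans (Nat.add_le_add_right hp.le 1), ?_⟩
  have := Obs.extra_le (S := S) (S' := S.addRow S.T x) (fun _ => List.mem_append_left _)
    (fun _ => id) (E := []) rfl
  rw [List.length_nil, Nat.zero_add] at this
  exact (this.trans h.extra_le).trans (Nat.mul_le_mul_right _ hp.le)

/-- One unit of progress pays for one EQ, one column and the MQs of one search. The transcript `t₁`
may already contain the EQ that provided the counterexample. -/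
theorem Bounds.addCol {t t₁ t' : Transcript α} {T' : Memo α} {v : List α} {P : List α → Prop}
    {p p' c c' : ℕ} (h : S.Bounds L t p c) (hMQ : numMQ t₁ = numMQ t)
    (hEQ : numEQ t₁ ≤ numEQ t + 1) (hc : c ≤ c') (ha : Asks L P S.T t₁ T' t' c')
    (hp : p < p') : (S.addCol T' v).Bounds L t' p' c' := by
  refine ⟨h.proper.addCol _ _, h.distinct.of_subset rfl (cols_subset_addCol _ _),
    ha.valid h.valid, ?_, ?_, ?_, ?_⟩
  · have := ha.numMQ_add
    have := h.numMQ_eq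
    change _ = T'.length
    omega
  · rw [ha.numEQ_eq]
    exact (hEQ.trans (Nat.add_le_add_right h.numEQ_le 1)).trans hp
  · have := h.length_V
    change (S.V ++ [v]).length ≤ _
    rw [List.length_append, List.length_singleton]
    omega
  · obtain ⟨E, rfl, hE, -⟩ := ha.new
    have h₁ := Obs.extra_le (S := S) (S' := S.addCol (E ++ S.T) v) (fun _ => id)
      (fun _ => List.mem_append_left _) rfl
    calc _ ≤ E.length + S.extra := h₁
      _ ≤ c' + p * c' := Nat.add_le_add hE (h.extra_le.trans (Nat.mul_le_mul_left _ hc))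
      _ = (p + 1) * c' := by ring
      _ ≤ _ := Nat.mul_le_mul_right _ hp

theorem Bounds.numMQ_le {t : Transcript α} {p c : ℕ} (h : S.Bounds L t p c)
    (hfin : (residuals L).Finite) :
    numMQ t ≤ (residuals L).ncard * (1 + Fintype.card α) * (p + 1) + p * c := by
  rw [h.numMQ_eq]
  refine (length_le_cells_add_extra h.valid).trans (Nat.add_le_add ?_ h.extra_le)
  rw [length_cells]
  exact Nat.mul_le_mul (Nat.mul_le_mul_right _ (h.distinct.length_le hfin)) h.length_V

/-- What holds between the rounds of `binaryNLStar`. -/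
structure Inv (L : Language α) (S : Obs α) (t : Transcript α) : Prop where
  bounds : S.Bounds L t (S.pot L) (searchCost (residuals L).ncard (maxCex t))
  -- The part `s` comes from a counterexample or is empty, and `x` was prepended by consistency
  -- steps. All suffixes of `v` that start within `x` or right after it are columns, so searches ask
  -- nothing there.
  shape : ∀ v ∈ S.V, ∃ x s, v = x ++ s ∧ s.length ≤ maxCex t ∧ ∀ y, y <:+ x → y ++ s ∈ S.V

theorem Inv.fill {t : Transcript α} (h : S.Inv L t) (Te : Teacher L) :
    ∃ T' t', (askAll S.cells S.T).exec Te t = (T', t') ∧ Inv L ⟨S.U, S.V, T'⟩ t' ∧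
      Filled L ⟨S.U, S.V, T'⟩ := by
  obtain ⟨T', t', h₁, h₂, h₃, h₄⟩ := h.bounds.fill Te
  exact ⟨T', t', h₁, ⟨h₄ ▸ h₂, h₄ ▸ h.shape⟩, h₃⟩

theorem Inv.addRow {t : Transcript α} (h : S.Inv L t) (hfin : (residuals L).Finite) {x : List α}
    (hx : x ∈ S.lower)
    (hne : ∀ u ∈ S.U, rowOf S.cols (L.leftQuotient u) ≠ rowOf S.cols (L.leftQuotient x)) :
    (S.addRow S.T x).Inv L t :=
  ⟨h.bounds.addRow (pot_lt_addRow hfin S.T x) hx hne, h.shape⟩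

theorem Inv.addCol {t t₁ t' : Transcript α} {T' : Memo α} {v : List α} {p : List α → Prop}
    (h : S.Inv L t) (hMQ : numMQ t₁ = numMQ t) (hEQ : numEQ t₁ ≤ numEQ t + 1)
    (hcex : maxCex t ≤ maxCex t₁)
    (ha : Asks L p S.T t₁ T' t' (searchCost (residuals L).ncard (maxCex t₁)))
    (hv : ∃ x s, v = x ++ s ∧ s.length ≤ maxCex t₁ ∧ ∀ y, y <:+ x → y ++ s ∈ S.V ++ [v])
    (hlt : S.pot L < (S.addCol T' v).pot L) : (S.addCol T' v).Inv L t' := by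
  constructor
  · rw [ha.maxCex_eq]
    exact h.bounds.addCol hMQ hEQ (searchCost_mono _ hcex) ha hlt
  · rw [ha.maxCex_eq]
    intro v' hv'
    rcases List.mem_append.1 hv' with hv' | hv'
    · obtain ⟨x, s, h₁, h₂, h₃⟩ := h.shape v' hv'
      exact ⟨x, s, h₁, h₂.trans hcex, fun y hy => List.mem_append_left _ (h₃ y hy)⟩
    · rw [List.mem_singleton] at hv'
      rw [hv']
      exact hv

theorem length_states_le : S.states.length ≤ S.U.length := List.length_filter_le _ _

theorem length_reach_le (w : List α) : (S.reach S.initial w).length ≤ S.states.length := by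
  induction w using List.reverseRecOn with
  | nil => exact List.length_filter_le _ _
  | append_singleton w a =>
    rw [reach_append_singleton]
    exact List.length_filter_le _ _

/-- The repair of a column succeeds. -/
theorem Inv.exec_repair {t : Transcript α} (h : S.Inv L t) (hfin : (residuals L).Finite)
    (hS : S.Filled L) (hc : S.Closed L) (Te : Teacher L) {v : List α} (hv : v ∈ S.V)
    (hbad : S.agrees S.T v = false) :
    ∃ S' t', (S.repair v).exec Te t = (S', t') ∧ S'.Inv L t' ∧ S.pot L < S'.pot L := by
  have hUr : ∀ q ∈ S.states, q ∈ S.rows := fun q hq => mem_rows_of_mem (List.mem_filter.1 hq).1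
  have hn : S.states.length ≤ (residuals L).ncard :=
    length_states_le.trans (h.bounds.distinct.length_le hfin)
  obtain ⟨x, s, rfl, hs, hx⟩ := h.shape v hv
  set v := x ++ s with hvdef
  let P : ℕ → Prop := fun i => ∀ q ∈ S.states, (q ++ v.drop i ∈ L ↔ S.accFrom q (v.drop i) = true)
  have hP0 : ¬ P 0 := fun hP => by
    refine Bool.eq_false_iff.1 hbad ((agrees_iff hS.valid fun q hq => ?_).2 hP)
    exact hS.known _ (mem_cells.2 ⟨q, hUr q hq, v, hv, rfl⟩)
  -- The empty suffix is good because `[]` is a column and acceptance of `[]` is read from it.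
  have hPl : P v.length := fun q hq => by
    rw [List.drop_length, accFrom_nil, ← hS.val_iff (hUr q hq) h.bounds.proper.nil_mem_V,
      List.append_nil]
  have hpos : 0 < v.length := Nat.pos_of_ne_zero fun h0 => hP0 (h0 ▸ hPl)
  have hdrop : ∀ i ≤ x.length, v.drop i = x.drop i ++ s := fun i hi =>
    List.drop_append_of_le_length hi
  obtain ⟨r, T', t', h₁, -, h₃, h₄, h₅, h₆⟩ := exec_bsearch Te
    (ws := fun i => S.states.map fun q => q ++ v.drop i)
    (test := fun T i => S.agrees T (v.drop i)) (P := P) (T₀ := S.T)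
    -- With `c` the length of `x`, only the positions inside `s` cost MQs.
    (k := (residuals L).ncard) (c := x.length)
    (fun i => by simpa using hn)
    (fun T i hT _ hk => agrees_iff hT fun q hq => hk _ (List.mem_map.2 ⟨q, hq, rfl⟩))
    (fun i hi w hw => by
      obtain ⟨q, hq, rfl⟩ := List.mem_map.1 hw
      refine hS.known _ (mem_cells.2 ⟨q, hUr q hq, _, ?_, rfl⟩)
      rw [hdrop i hi]
      exact hx _ (List.drop_suffix i x))
    0 v.length S.T t h.bounds.valid (fun _ => id) hpos hP0 hPl
  have hdr : v.drop r = v[r] :: v.drop (r + 1) := List.drop_eq_getElem_cons h₃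
  have hlt : S.pot L < (S.addCol T' (v.drop (r + 1))).pot L :=
    hS.pot_lt_repair hc hfin T' (a := v[r]) h₅ (by rw [← hdr]; exact h₄)
  refine ⟨S.addCol T' (v.drop (r + 1)), t', ?_, ?_, hlt⟩
  · rw [Obs.repair, Prog.exec_bind, h₁]
    rfl
  · refine h.addCol rfl (Nat.le_succ _) le_rfl (h₆.mono ?_ fun _ => id) ?_ hlt
    · refine le_trans (Nat.mul_le_mul_left _ (Nat.add_le_add
        (d := 1) (Nat.clog_mono_right 2 (m := maxCex t) ?_) ?_)) (Nat.le_succ _)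
      · rw [hvdef, List.length_append]
        omega
      · split_ifs <;> omega
    -- A cut within `x` or right after it keeps the decomposition; a cut inside `s` leaves a short
    -- column, which needs no prepended part.
    · by_cases hr : r + 1 ≤ x.length
      · refine ⟨x.drop (r + 1), s, hdrop _ hr, hs, fun y hy => List.mem_append_left _ (hx y ?_)⟩
        exact hy.trans (List.drop_suffix _ x)
      · refine ⟨[], v.drop (r + 1), rfl, ?_, fun y hy => ?_⟩
        · rw [List.length_drop, hvdef, List.length_append]
          omega
        · rw [List.suffix_nil.1 hy]
          exact List.mem_append_right _ (List.mem_singleton_self _)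

theorem disj_iff {T : Memo α} {w : List α} {i : ℕ} (hT : T.Valid L)
    (hk : ∀ q ∈ S.reach S.initial (w.take i), Known T (q ++ w.drop i)) :
    S.disj T w i = true ↔ ∃ q ∈ S.reach S.initial (w.take i), q ++ w.drop i ∈ L := by
  simp only [disj, List.any_eq_true]
  exact exists_congr fun q => and_congr_right fun hq => hT.val_iff (hk q hq)

/-- The processing of a counterexample succeeds. -/
theorem Inv.exec_refine {t t₁ : Transcript α} (h : S.Inv L t) (hfin : (residuals L).Finite)
    (hS : S.Filled L) (hc : S.Closed L) (Te : Teacher L) {w : List α}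
    (hMQ : numMQ t₁ = numMQ t) (hEQ : numEQ t₁ ≤ numEQ t + 1) (hcex : maxCex t ≤ maxCex t₁)
    (hwl : w.length ≤ maxCex t₁) (hw : ¬ (w ∈ S.hyp.lang ↔ w ∈ L)) :
    ∃ S' t', (S.refine w).exec Te t₁ = (S', t') ∧ S'.Inv L t' ∧ S.pot L < S'.pot L := by
  have hn : S.states.length ≤ (residuals L).ncard :=
    length_states_le.trans (h.bounds.distinct.length_le hfin)
  have hi : S.initial.length ≤ (residuals L).ncard := (List.length_filter_le _ _).trans hn
  have hst := reach_subset_states (S := S) initial_subset_states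
  obtain ⟨T₁, t₂, h₁, h₂, h₃, -⟩ :=
    exec_askAll Te (w :: S.initial.map fun q => q ++ w) S.T t₁
  have hT₁ := h₂.valid h.bounds.valid
  have hcost : (w :: S.initial.map fun q => q ++ w).length ≤ (residuals L).ncard + 1 := by
    simpa using hi
  have hcol : ∀ i, ∃ x s, w.drop i = x ++ s ∧ s.length ≤ maxCex t₁ ∧
      ∀ y, y <:+ x → y ++ s ∈ S.V ++ [w.drop i] := fun i => by
    refine ⟨[], w.drop i, rfl, ?_, fun y hy => ?_⟩
    · rw [List.length_drop]
      omega
    · rw [List.suffix_nil.1 hy]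
      exact List.mem_append_right _ (List.mem_singleton_self _)
  have hwk : Known T₁ w := h₃ w List.mem_cons_self
  have hvw := hT₁.val_iff hwk
  have hk0 : ∀ q ∈ S.reach S.initial (w.take 0), Known T₁ (q ++ w.drop 0) := fun q hq =>
    h₃ _ (List.mem_cons_of_mem _ (List.mem_map.2 ⟨q, hq, rfl⟩))
  have hd0 := disj_iff hT₁ hk0
  let P : ℕ → Prop := fun i =>
    ¬ ((∃ q ∈ S.reach S.initial (w.take i), q ++ w.drop i ∈ L) ↔ w ∈ L)
  by_cases hP0 : P 0
  · have hlt : S.pot L < (S.addCol T₁ w).pot L :=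
      hS.pot_lt_initial h.bounds.proper hc hfin T₁ hP0
    refine ⟨S.addCol T₁ w, t₂, ?_, h.addCol hMQ hEQ hcex (h₂.mono ?_ fun _ => id) (hcol 0) hlt,
      hlt⟩
    · rw [Obs.refine, Prog.exec_bind, h₁]
      have : (S.disj T₁ w 0 != val T₁ w) = true := by
        rw [bne_iff_ne, Ne, Bool.eq_iff_iff, hd0, hvw]
        exact hP0
      simp only [this, if_true]
      rfl
    · refine hcost.trans (Nat.add_le_add_right (Nat.le_mul_of_pos_right _ (Nat.succ_pos _)) 1)
  -- At the right end the disjunction is the verdict of the hypothesis on `w`, which is wrong by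
  -- assumption.
  · have hPl : P w.length := by
      simp only [P, List.take_length, List.drop_length, List.append_nil]
      rw [mem_lang_hyp] at hw
      refine fun hc => hw (Iff.trans (exists_congr fun q => and_congr_right fun hq => ?_) hc)
      have := hS.val_iff (mem_rows_of_mem (List.mem_filter.1 (hst w q hq)).1)
        h.bounds.proper.nil_mem_V
      rwa [List.append_nil] at this
    have hpos : 0 < w.length := Nat.pos_of_ne_zero fun h0 => hP0 (h0 ▸ hPl)
    obtain ⟨r, T', t', h₄, -, h₅, h₆, h₇, h₈⟩ := exec_bsearch Te
      (ws := fun i => (S.reach S.initial (w.take i)).map fun q => q ++ w.drop i)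
      (test := fun T' i => S.disj T' w i != val T₁ w) (P := P) (T₀ := T₁)
      -- The test at 0 has been answered by the first queries; these cost at most `n + 1` MQs, which
      -- together with the search gives `searchCost`.
      (k := (residuals L).ncard) (c := 0)
      (fun i => by
        rw [List.length_map]
        exact (length_reach_le _).trans hn)
      (fun T i hT hle hk => by
        rw [bne_iff_ne, Ne, Bool.eq_iff_iff, hvw,
          disj_iff hT fun q hq => hk _ (List.mem_map.2 ⟨q, hq, rfl⟩)])
      (fun i hi w' hw' => by
        obtain rfl : i = 0 := by omega
        obtain ⟨q, hq, rfl⟩ := List.mem_map.1 hw'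
        exact hk0 q hq)
      0 w.length T₁ t₂ hT₁ (fun _ => id) hpos hP0 hPl
    have hdr : w.drop r = w[r] :: w.drop (r + 1) := List.drop_eq_getElem_cons h₅
    have htk : S.reach S.initial (w.take (r + 1)) =
        S.stepSet (S.reach S.initial (w.take r)) w[r] := by
      rw [← reach_append_singleton, List.take_append_getElem]
    have hlt : S.pot L < (S.addCol T' (w.drop (r + 1))).pot L := by
      refine hS.pot_lt_refine hc hfin T' (hst (w.take r)) (a := w[r]) fun he => h₇ ?_
      rw [htk, ← he, ← hdr]
      exact not_not.1 h₆
    refine ⟨S.addCol T' (w.drop (r + 1)), t', ?_, h.addCol hMQ hEQ hcex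
      (((h₂.mono hcost fun _ _ => trivial).trans h₈).mono ?_ fun _ => id) (hcol (r + 1)) hlt, hlt⟩
    · rw [Obs.refine, Prog.exec_bind, h₁]
      have : (S.disj T₁ w 0 != val T₁ w) = false := by
        rw [bne_eq_false_iff_eq, Bool.eq_iff_iff, hd0, hvw]
        exact not_not.1 hP0
      simp only [this, Bool.false_eq_true, if_false]
      rw [Prog.exec_bind, h₄]
      rfl
    · have := Nat.clog_mono_right 2 (show w.length - max 0 0 ≤ maxCex t₁ by omega)
      have := Nat.mul_le_mul_left (residuals L).ncard this
      rw [searchCost, if_neg (lt_irrefl 0)]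
      simp only [Nat.mul_add, Nat.mul_one, Nat.mul_zero]
      omega

end Obs

theorem Teacher.not_mem_iff {α : Type} {L : Language α} (Te : Teacher L) {t : Transcript α}
    {H : FinNFA α} {w : List α} (h : Te.reply t H = some w) : ¬ (w ∈ H.lang ↔ w ∈ L) := by
  rcases Te.reply_some t H w h with h | h
  · exact fun he => h.2 (he.2 h.1)
  · exact fun he => h.2 (he.1 h.1)

/-! ### Rounds and termination of `binaryNLStar` -/

namespace Obs

variable {α : Type} [FinEnum α] {L : Language α} {S : Obs α}

theorem bounds_start (p c : ℕ) : Bounds L ⟨[[]], [[]], []⟩ ([] : Transcript α) p c where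
  proper := ⟨List.mem_singleton_self _, List.mem_singleton_self _, fun u a h => by simp at h⟩
  distinct := List.pairwise_singleton _ _
  valid := ⟨fun w b h => by simp at h, List.nodup_nil⟩
  numMQ_eq := rfl
  numEQ_le := Nat.zero_le _
  length_V := Nat.le_add_left 1 p
  extra_le := Nat.zero_le _

theorem inv_start : Inv L ⟨[[]], [[]], []⟩ ([] : Transcript α) where
  bounds := bounds_start _ _
  shape v hv := by
    rw [List.mem_singleton] at hv
    refine ⟨[], [], hv, le_rfl, fun y hy => ?_⟩
    rw [List.suffix_nil.1 hy]
    exact List.mem_singleton_self _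

omit [FinEnum α] in
theorem length_le_maxCex_cons (H : FinNFA α) (w : List α) (t : Transcript α) :
    w.length ≤ maxCex (.equiv H (some w) :: t) ∧ maxCex t ≤ maxCex (.equiv H (some w) :: t) :=
  ⟨le_max_left _ _, le_max_right _ _⟩

/-- A filled table is extended, or the learner halts with a correct output. -/
theorem Inv.exec_act {t : Transcript α} (h : S.Inv L t) (hfin : (residuals L).Finite)
    (hS : S.Filled L) (Te : Teacher L) :
    (∃ S' t', S.act.exec Te t = (Sum.inl S', t') ∧ S'.Inv L t' ∧ S.pot L < S'.pot L) ∨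
      ∃ H t', S.act.exec Te t = (Sum.inr H, t') ∧ H.lang = L ∧
        Nonempty (NFAIso H.toNFA (canonicalRFA L)) ∧ numMQ t' = numMQ t ∧
        numEQ t' = numEQ t + 1 ∧ maxCex t' = maxCex t := by
  unfold act
  cases hu : S.unclosed with
  | some x =>
    obtain ⟨hx, hne⟩ := hS.of_unclosed_some hu
    exact Or.inl ⟨_, t, rfl, h.addRow hfin hx hne, pot_lt_addRow hfin _ _⟩
  | none =>
    have hc := hS.closed hu
    cases hi : S.inconsistent with
    | some w =>
      obtain ⟨u, hu, u', hu', a, v, hv, rfl, hle, h₁, h₂⟩ := hS.of_inconsistent_some hi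
      have hlt := pot_lt_addCol_of_rowLE hfin S.T (mem_rows_of_mem hu) (mem_rows_of_mem hu') hle
        h₁ h₂
      refine Or.inl ⟨_, t, rfl, h.addCol rfl (Nat.le_succ _) le_rfl
        ((Asks.refl L (fun _ => True) S.T t).mono (Nat.zero_le _) fun _ => id) ?_ hlt, hlt⟩
      obtain ⟨x, s, rfl, hs, hx⟩ := h.shape v hv
      -- The letter goes to the prepended part; its only new suffix is `a :: x`, which gives the new
      -- column itself.
      refine ⟨a :: x, s, rfl, hs, fun y hy => ?_⟩
      rcases List.suffix_cons_iff.1 hy with rfl | hy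
      · exact List.mem_append_right _ (List.mem_singleton_self _)
      · exact List.mem_append_left _ (hx y hy)
    | none =>
      cases hb : S.badColumn with
      | some v =>
        obtain ⟨hv, hbad⟩ := mem_of_badColumn_some hb
        obtain ⟨S', t', h₁, h₂, h₃⟩ := h.exec_repair hfin hS hc Te hv hbad
        refine Or.inl ⟨S', t', ?_, h₂, h₃⟩
        simp only [Prog.exec_bind, h₁, Prog.exec]
      | none =>
        have hgood : ∀ v ∈ S.V, ∀ q ∈ S.states, (q ++ v ∈ L ↔ S.accFrom q v = true) :=
          fun v hv => (agrees_iff hS.valid fun q hq => hS.known _ (mem_cells.2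
            ⟨q, mem_rows_of_mem (List.mem_filter.1 hq).1, v, hv, rfl⟩)).1
            (agrees_of_badColumn_none hb v hv)
        cases hr : Te.reply t S.hyp with
        | none =>
          have hL := (Te.reply_none_iff t S.hyp).1 hr
          refine Or.inr ⟨S.hyp, .equiv S.hyp none :: t, ?_, hL, nonempty_iso_hyp hS h.bounds.proper
            (hS.consistent hi) hgood hL h.bounds.distinct, rfl, rfl, rfl⟩
          simp only [Prog.exec, hr]
        | some w =>
          obtain ⟨h₁, h₂⟩ := length_le_maxCex_cons S.hyp w t
          obtain ⟨S', t', h₃, h₄, h₅⟩ := h.exec_refine (t₁ := .equiv S.hyp (some w) :: t) hfin hS hc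
            Te rfl le_rfl h₂ h₁ (Te.not_mem_iff hr)
          refine Or.inl ⟨S', t', ?_, h₄, h₅⟩
          simp only [Prog.exec, hr, Prog.exec_bind, h₃]

/-- Induction on the gap between the potential and its bound. The transcript `t₀` is the one before
the last EQ, where the invariant still gives the counts. -/
theorem Inv.exists_halts {t : Transcript α} (h : S.Inv L t) (hfin : (residuals L).Finite)
    (Te : Teacher L) : ∃ H t', (binaryNLStar α).Halts Te S t H t' ∧ H.lang = L ∧
      Nonempty (NFAIso H.toNFA (canonicalRFA L)) ∧ ∃ (S' : Obs α) (t₀ : Transcript α),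
        S'.Inv L t₀ ∧ numMQ t' = numMQ t₀ ∧ numEQ t' = numEQ t₀ + 1 ∧ maxCex t' = maxCex t₀ := by
  induction hd : 7 * (residuals L).ncard ^ 2 - S.pot L using Nat.strong_induction_on
    generalizing S t with
  | _ d ih =>
  obtain ⟨T', t₁, h₁, h₂, h₃⟩ := h.fill Te
  have hround : ((binaryNLStar α).round S).exec Te t = (act ⟨S.U, S.V, T'⟩).exec Te t₁ := by
    change ((askAll S.cells S.T).bind fun T => act ⟨S.U, S.V, T⟩).exec Te t = _
    rw [Prog.exec_bind, h₁]
  rcases h₂.exec_act hfin h₃ Te with ⟨S', t', h₄, h₅, h₆⟩ | ⟨H, t', h₄, h₅, h₆, h₇⟩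
  · have hle := pot_le hfin (h₅.bounds.distinct.length_le hfin)
    have h₆' : S.pot L < S'.pot L := h₆
    obtain ⟨H, t'', h₈, h₉⟩ := ih _ (by omega) h₅ rfl
    exact ⟨H, t'', .more (hround.trans h₄) h₈, h₉⟩
  · exact ⟨H, t', .done (hround.trans h₄), h₅, h₆, _, t₁, h₂, h₇⟩

end Obs

/-! ### Numerical bounds for `binaryNLStar` -/

theorem clog_two_le (m : ℕ) : (Nat.clog 2 m : ℝ) ≤ 1 + 2 * Real.log m := by
  rcases Nat.lt_or_ge 1 m with hm | hm
  · have hc := Nat.clog_pos one_lt_two hm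
    have h := Nat.pow_pred_clog_lt_self one_lt_two hm
    have h' : ((2 : ℝ) ^ (Nat.clog 2 m).pred) ≤ m := by exact_mod_cast h.le
    have h₁ := Real.log_le_log (by positivity) h'
    rw [Real.log_pow] at h₁
    -- The factor 2 comes from `log 2 > 1 / 2`.
    have h₂ := Real.log_two_gt_d9
    have h₃ : (Nat.clog 2 m : ℝ) = ((Nat.clog 2 m).pred : ℕ) + 1 := by
      exact_mod_cast (Nat.succ_pred_eq_of_pos hc).symm
    have h₄ : (0 : ℝ) ≤ ((Nat.clog 2 m).pred : ℕ) := Nat.cast_nonneg _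
    rw [h₃]
    nlinarith
  · rw [Nat.clog_of_right_le_one hm, Nat.cast_zero]
    have := Real.log_natCast_nonneg m
    linarith

theorem residuals_ncard_pos {α : Type} {L : Language α} (hfin : (residuals L).Finite) :
    0 < (residuals L).ncard :=
  (Set.ncard_pos hfin).2 ⟨L, [], Language.leftQuotient_nil L⟩

/-- Correctness and query complexity of `binaryNLStar`. -/
theorem binaryNLStar_run (α : Type) [FinEnum α] [Nonempty α] {L : Language α} (hL : L.IsRegular)
    (Te : Teacher L) : ∃ (H : FinNFA α) (t : Transcript α), (binaryNLStar α).Run Te H t ∧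
      H.lang = L ∧ Nonempty (NFAIso H.toNFA (canonicalRFA L)) ∧
      (numEQ t : ℝ) ≤ 40 * ((residuals L).ncard : ℝ) ^ 2 ∧
      (numMQ t : ℝ) ≤ 40 * (((residuals L).ncard : ℝ) ^ 3 * (Fintype.card α : ℝ) +
        ((residuals L).ncard : ℝ) ^ 3 * Real.log (maxCex t : ℝ)) := by
  have hfin : (residuals L).Finite := hL.finite_range_leftQuotient
  obtain ⟨H, t, hrun, hlang, hiso, S, t₀, hinv, hMQ, hEQ, hcex⟩ :=
    Obs.inv_start.exists_halts hfin Te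
  refine ⟨H, t, hrun, hlang, hiso, ?_⟩
  have hp := Obs.pot_le hfin (hinv.bounds.distinct.length_le hfin)
  have hM := hinv.bounds.numMQ_le hfin
  have hE := hinv.bounds.numEQ_le
  rw [hMQ, hEQ, hcex]
  have hn : 1 ≤ (residuals L).ncard := residuals_ncard_pos hfin
  have hk : 1 ≤ Fintype.card α := Fintype.card_pos
  set n := (residuals L).ncard
  set k := Fintype.card α
  have hlog := clog_two_le (maxCex t₀)
  have hl := Real.log_natCast_nonneg (maxCex t₀)
  set l := Real.log (maxCex t₀)
  have hn' : (1 : ℝ) ≤ n := by exact_mod_cast hn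
  have hk' : (1 : ℝ) ≤ k := by exact_mod_cast hk
  constructor
  · have : numEQ t₀ + 1 ≤ 40 * n ^ 2 := by nlinarith
    exact_mod_cast this
  · have h₁ : numMQ t₀ ≤ n * (1 + k) * (7 * n ^ 2 + 1) +
        7 * n ^ 2 * Obs.searchCost n (maxCex t₀) :=
      hM.trans (Nat.add_le_add (Nat.mul_le_mul_left _ (Nat.add_le_add_right hp 1))
        (Nat.mul_le_mul_right _ hp))
    have h₂ : (numMQ t₀ : ℝ) ≤ n * (1 + k) * (7 * n ^ 2 + 1) +
        7 * n ^ 2 * (n * (Nat.clog 2 (maxCex t₀) + 1) + 1) := by exact_mod_cast h₁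
    -- The cells contribute at most `16 * n ^ 3 * k` and the searches at most `21 * n ^ 3 + 14 * n ^
    -- 3 * l`, so 40 suffices.
    have h₃ : (n : ℝ) * (1 + k) * (7 * n ^ 2 + 1) ≤ n * (k + k) * (7 * n ^ 2 + n ^ 2) := by
      gcongr
      exact one_le_pow₀ hn'
    have h₄ : 7 * (n : ℝ) ^ 2 * (n * (Nat.clog 2 (maxCex t₀) + 1) + 1) ≤
        7 * n ^ 2 * (n * (1 + 2 * l + 1) + n) := by gcongr
    have h₅ : (n : ℝ) ^ 3 ≤ n ^ 3 * k := le_mul_of_one_le_right (by positivity) hk'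
    have h₆ : 0 ≤ (n : ℝ) ^ 3 * l := by positivity
    nlinarith

/-! ### The canonical residual automaton accepts its language -/

section Canonical

variable {α : Type}

theorem leftQuotient_mem_residuals {L K : Language α} (hK : K ∈ residuals L) (w : List α) :
    K.leftQuotient w ∈ residuals L := by
  obtain ⟨u, rfl⟩ := hK
  exact ⟨u ++ w, Language.leftQuotient_append L u w⟩

/-- Each state `K` accepts `K`: its `a`-successors are the primes below the residual of `K` by `a`,
and their union is that residual. -/
theorem mem_acceptsFrom_canonicalRFA {L : Language α} (hfin : (residuals L).Finite)
    (P : Set (primes (residuals L))) (w : List α) :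
    w ∈ (canonicalRFA L).acceptsFrom P ↔ ∃ K ∈ P, w ∈ K.1 := by
  induction w generalizing P with
  | nil => exact NFA.nil_mem_acceptsFrom _
  | cons a w ih =>
    rw [NFA.cons_mem_acceptsFrom, ih]
    simp only [NFA.mem_stepSet]
    constructor
    · rintro ⟨K', ⟨K, hK, hle⟩, hw⟩
      exact ⟨K, hK, hle hw⟩
    · rintro ⟨K, hK, hw⟩
      obtain ⟨K', h₁, h₂, h₃⟩ := exists_prime_le hfin
        (leftQuotient_mem_residuals K.2.1 [a]) (v := w) hw
      exact ⟨⟨K', h₁⟩, ⟨K, hK, h₂⟩, h₃⟩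

theorem accepts_canonicalRFA {L : Language α} (hfin : (residuals L).Finite) :
    (canonicalRFA L).accepts = L := by
  ext w
  rw [NFA.accepts_eq_acceptsFrom_start, mem_acceptsFrom_canonicalRFA hfin]
  constructor
  · rintro ⟨K, hle, hw⟩
    exact hle hw
  · intro hw
    obtain ⟨K, h₁, h₂, h₃⟩ := exists_prime_le hfin ⟨[], Language.leftQuotient_nil L⟩ hw
    exact ⟨⟨K, h₁⟩, h₂, h₃⟩

theorem NFAIso.accepts_eq {σ τ : Type} {M : NFA α σ} {N : NFA α τ} (f : NFAIso M N) :
    M.accepts = N.accepts := by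
  have key : ∀ (w : List α) (A : Set σ),
      N.evalFrom (f.toEquiv '' A) w = f.toEquiv '' M.evalFrom A w := by
    intro w
    induction w with
    | nil => exact fun _ => rfl
    | cons a w ih =>
      intro A
      rw [NFA.evalFrom_cons, NFA.evalFrom_cons, ← ih]
      congr 1
      ext q
      obtain ⟨p, rfl⟩ := f.toEquiv.surjective q
      rw [NFA.mem_stepSet, f.toEquiv.injective.mem_set_image, NFA.mem_stepSet, Set.exists_mem_image]
      simp only [f.step_iff]
  have hstart : N.start = f.toEquiv '' M.start := by
    ext q
    obtain ⟨p, rfl⟩ := f.toEquiv.surjective q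
    rw [f.toEquiv.injective.mem_set_image, f.start_iff]
  ext w
  rw [NFA.mem_accepts, NFA.mem_accepts, hstart, key]
  constructor
  · rintro ⟨q, h₁, h₂⟩
    exact ⟨f.toEquiv q, (f.accept_iff q).2 h₁, Set.mem_image_of_mem _ h₂⟩
  · rintro ⟨_, h₁, q, h₂, rfl⟩
    exact ⟨q, (f.accept_iff q).1 h₁, h₂⟩

open Classical in
theorem exists_finNFA_iso {σ : Type} [Finite σ] (M : NFA α σ) :
    ∃ H : FinNFA α, Nonempty (NFAIso H.toNFA M) := by
  obtain ⟨n, ⟨e⟩⟩ := Finite.exists_equiv_fin σ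
  refine ⟨⟨n, fun i => decide (e.symm i ∈ M.start), fun i => decide (e.symm i ∈ M.accept),
    fun i a j => decide (e.symm j ∈ M.step (e.symm i) a)⟩, ⟨⟨e.symm, fun q => ?_, fun q => ?_,
    fun q a q' => ?_⟩⟩⟩ <;> simp [FinNFA.toNFA]

open Classical in
/-- A concrete presentation of the canonical residual automaton of the language of `H`. -/
noncomputable def FinNFA.canonical (H : FinNFA α) : FinNFA α :=
  -- The value `H` is a dummy: the condition holds whenever the language has finitely many
  -- residuals.
  if h : ∃ N : FinNFA α, Nonempty (NFAIso N.toNFA (canonicalRFA H.lang)) then h.choose else H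

theorem FinNFA.nonempty_iso_canonical {H : FinNFA α} (hfin : (residuals H.lang).Finite) :
    Nonempty (NFAIso H.canonical.toNFA (canonicalRFA H.lang)) := by
  have : Finite (primes (residuals H.lang)) := hfin.subset fun _ h => h.1
  have h := exists_finNFA_iso (canonicalRFA H.lang)
  rw [canonical, dif_pos h]
  exact h.choose_spec

theorem FinNFA.lang_canonical {H : FinNFA α} (hfin : (residuals H.lang).Finite) :
    H.canonical.lang = H.lang := by
  obtain ⟨f⟩ := nonempty_iso_canonical hfin
  exact f.accepts_eq.trans (accepts_canonicalRFA hfin)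

end Canonical

/-! ### A learner with deterministic hypotheses -/

namespace Obs

section Deterministic

variable {α : Type} [FinEnum α]

/-- `row(x) = row(y)`. -/
def rowEq (S : Obs α) (x y : List α) : Bool := S.rowLe x y && S.rowLe y x

/-- A lower row that is equal to no upper row, if there is one. -/
def newRow (S : Obs α) : Option (List α) := S.lower.find? fun x => S.U.all fun u => !S.rowEq x u

/-- The upper row string with the same row as `u a`. -/
def next (S : Obs α) (u : List α) (a : α) : List α :=
  -- The default `u` is never used for upper rows `u` once `newRow` finds nothing.
  (S.U.find? fun u' => S.rowEq (u ++ [a]) u').getD u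

/-- The state of the deterministic hypothesis after reading a word. -/
def run (S : Obs α) (w : List α) : List α := w.foldl S.next []

/-- The deterministic hypothesis, whose states are the upper row strings. -/
def detHyp (S : Obs α) : FinNFA α where
  size := S.U.length
  init i := decide (S.U[i] = [])
  final i := val S.T S.U[i]
  trans i a j := decide (S.U[j] = S.next S.U[i] a)

/-- Binary search on a counterexample `w` for a decomposition `w = u a v` such that `s a v` and
`s' v` have different answers, where `s` and `s'` are the states after `u` and `u a`. -/
def detRefine (S : Obs α) (w : List α) : Prog α (Obs α) :=
  (askAll [w] S.T).bind fun T =>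
    (bsearch (fun i => [S.run (w.take i) ++ w.drop i])
      (fun T' i => val T' (S.run (w.take i) ++ w.drop i) != val T w) 0 w.length T).bind fun r =>
        .ret (S.addCol r.2 (w.drop (r.1 + 1)))

/-- What the deterministic learner does with a completely filled table. -/
noncomputable def detAct (S : Obs α) : Prog α (Obs α ⊕ FinNFA α) :=
  match S.newRow with
  | some x => .ret (.inl (S.addRow S.T x))
  | none => .equivQ S.detHyp fun
    | none => .ret (.inr S.detHyp.canonical)
    | some w => (S.detRefine w).bind fun S' => .ret (.inl S')

end Deterministic

end Obs

/-- A learner that finds the minimal deterministic automaton of the target and outputs its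
canonical residual automaton. -/
noncomputable def detLearner (α : Type) [FinEnum α] : Learner α where
  State := Obs α
  start := ⟨[[]], [[]], []⟩
  round S := (askAll S.cells S.T).bind fun T => Obs.detAct ⟨S.U, S.V, T⟩

/-! ### Correctness and query count of `detLearner` -/

namespace Obs

variable {α : Type} [FinEnum α] {L : Language α} {S : Obs α}

theorem Filled.rowEq_iff (hS : S.Filled L) {x y : List α} (hx : x ∈ S.rows) (hy : y ∈ S.rows) :
    S.rowEq x y = true ↔
      rowOf S.cols (L.leftQuotient x) = rowOf S.cols (L.leftQuotient y) := by
  rw [rowEq, Bool.and_eq_true, hS.rowLe_iff hx hy, hS.rowLe_iff hy hx, rowOf_eq_iff]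

theorem Filled.of_newRow_some (hS : S.Filled L) {x : List α} (h : S.newRow = some x) :
    x ∈ S.lower ∧ ∀ u ∈ S.U, rowOf S.cols (L.leftQuotient u) ≠ rowOf S.cols (L.leftQuotient x) := by
  have hx := List.mem_of_find?_eq_some h
  have hp := List.find?_some h
  simp only [List.all_eq_true, Bool.not_eq_true'] at hp
  refine ⟨hx, fun u hu he => ?_⟩
  exact Bool.eq_false_iff.1 (hp u hu)
    ((hS.rowEq_iff (List.mem_append_right _ hx) (mem_rows_of_mem hu)).2 he.symm)

theorem Filled.next_spec (hS : S.Filled L) (h : S.newRow = none) {u : List α} (hu : u ∈ S.U)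
    (a : α) : S.next u a ∈ S.U ∧
      rowOf S.cols (L.leftQuotient (u ++ [a])) = rowOf S.cols (L.leftQuotient (S.next u a)) := by
  have hx := List.find?_eq_none.1 h (u ++ [a]) (mem_lower.2 ⟨u, hu, a, rfl⟩)
  simp only [List.all_eq_true, not_forall, Bool.not_eq_true', Bool.not_eq_false,
    exists_prop] at hx
  obtain ⟨u', hu', he⟩ := hx
  have hs : (S.U.find? fun u' => S.rowEq (u ++ [a]) u').isSome = true :=
    List.find?_isSome.2 ⟨u', hu', he⟩
  obtain ⟨u₀, h₀⟩ := Option.isSome_iff_exists.1 hs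
  have hn : S.next u a = u₀ := by rw [next, h₀, Option.getD_some]
  have hm := List.mem_of_find?_eq_some h₀
  rw [hn]
  exact ⟨hm, (hS.rowEq_iff (append_mem_rows hu a) (mem_rows_of_mem hm)).1 (List.find?_some h₀)⟩

theorem run_append_singleton (w : List α) (a : α) : S.run (w ++ [a]) = S.next (S.run w) a := by
  simp [run]

theorem Filled.run_mem (hS : S.Filled L) (hp : S.Proper) (h : S.newRow = none) (w : List α) :
    S.run w ∈ S.U := by
  induction w using List.reverseRecOn with
  | nil => exact hp.nil_mem_U
  | append_singleton w a ih =>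
    rw [run_append_singleton]
    exact (hS.next_spec h ih a).1

/-- After `w` the automaton is exactly in the positions that hold the string `run w`, and the column
`[]` decides whether that string is in `L`. -/
theorem Filled.mem_lang_detHyp (hS : S.Filled L) (hp : S.Proper) (h : S.newRow = none)
    (w : List α) : w ∈ S.detHyp.lang ↔ S.run w ∈ L := by
  have hev : ∀ w (i : Fin S.U.length), i ∈ S.detHyp.toNFA.eval w ↔ S.U[i] = S.run w := by
    intro w
    induction w using List.reverseRecOn with
    | nil => exact fun i => decide_eq_true_iff
    | append_singleton w a ih =>
      intro i
      rw [NFA.eval_append_singleton, run_append_singleton]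
      refine Iff.trans NFA.mem_stepSet ⟨?_, fun hi => ?_⟩
      · rintro ⟨j, hj, hij⟩
        rw [← (ih j).1 hj]
        exact of_decide_eq_true hij
      · obtain ⟨j, hj, he⟩ := List.getElem_of_mem (hS.run_mem hp h w)
        refine ⟨(⟨j, hj⟩ : Fin S.U.length), (ih _).2 he, decide_eq_true ?_⟩
        rw [hi]
        exact congrArg (S.next · a) he.symm
  have hval := hS.val_iff (mem_rows_of_mem (hS.run_mem hp h w)) hp.nil_mem_V
  rw [List.append_nil] at hval
  rw [← hval, FinNFA.lang]
  constructor
  · rintro ⟨i, hi, hw⟩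
    rw [← (hev w i).1 hw]
    exact hi
  · intro hv
    obtain ⟨j, hj, he⟩ := List.getElem_of_mem (hS.run_mem hp h w)
    refine ⟨(⟨j, hj⟩ : Fin S.U.length), ?_, (hev w _).2 he⟩
    change val S.T S.U[j] = true
    rw [he]
    exact hv

/-- The number of upper row strings and of distinct rows. -/
noncomputable def detPot (L : Language α) (S : Obs α) : ℕ :=
  S.U.length + (rowOf S.cols '' S.res L).ncard

theorem detPot_le (hfin : (residuals L).Finite) (hU : S.Distinct L) :
    S.detPot L ≤ 2 * (residuals L).ncard := by
  have h₁ := hU.length_le hfin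
  have h₂ := Set.ncard_image_le (f := rowOf S.cols) (hfin.subset (S.res_subset L))
  have h₃ := Set.ncard_le_ncard (S.res_subset L) hfin
  unfold detPot
  omega

theorem detPot_lt_addRow (hfin : (residuals L).Finite) (T : Memo α) (x : List α) :
    S.detPot L < (S.addRow T x).detPot L := by
  have h := Set.ncard_le_ncard
    (Set.image_mono (f := rowOf S.cols) (res_subset_addRow (S := S) (L := L) T x))
    ((hfin.subset (res_subset L _)).image _)
  have h₁ : (S.addRow T x).U.length = S.U.length + 1 := by simp [addRow]
  have h₂ : (S.addRow T x).cols = S.cols := rfl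
  rw [detPot, detPot, h₁, h₂]
  omega

/-- The new column splits two rows that were equal, so the number of distinct rows grows. -/
theorem detPot_lt_addCol (hfin : (residuals L).Finite) (T : Memo α) {x y v : List α}
    (hx : x ∈ S.rows) (hy : y ∈ S.rows)
    (he : rowOf S.cols (L.leftQuotient x) = rowOf S.cols (L.leftQuotient y))
    (hv : ¬ (x ++ v ∈ L ↔ y ++ v ∈ L)) : S.detPot L < (S.addCol T v).detPot L := by
  by_contra hlt
  have hR := hfin.subset (S.res_subset L)
  have hV := cols_subset_addCol (S := S) T v
  have hle : (rowOf (S.addCol T v).cols '' S.res L).ncard ≤ (rowOf S.cols '' S.res L).ncard := by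
    have h := not_lt.1 hlt
    rw [detPot, detPot, res_addCol] at h
    exact Nat.le_of_add_le_add_left h
  obtain ⟨h₁, h₂⟩ := rowOf_eq_iff.1 he
  have hm := mem_cols_addCol (S := S) T v
  exact hv ⟨rowLE_of_ncard_rowOf_le hR hV hle (mem_res hx) (mem_res hy) h₁ h₂ v hm,
    rowLE_of_ncard_rowOf_le hR hV hle (mem_res hy) (mem_res hx) h₂ h₁ v hm⟩

/-- What holds between the rounds of `detLearner`. -/
abbrev DetInv (L : Language α) (S : Obs α) (t : Transcript α) : Prop :=
  S.Bounds L t (S.detPot L) (Nat.clog 2 (maxCex t) + 1)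

/-- Replacing a prefix of `w` by the state it leads to preserves the answer at position 0 and spoils
it at the end. Where it changes, `s a` and its successor `s'` have equal rows but disagree on the
remaining suffix. One MQ on `w` and one for each test suffice. -/
theorem exec_detRefine {t t₁ : Transcript α} (h : S.DetInv L t) (hfin : (residuals L).Finite)
    (hS : S.Filled L) (hc : S.newRow = none) (Te : Teacher L) {w : List α}
    (hMQ : numMQ t₁ = numMQ t) (hEQ : numEQ t₁ ≤ numEQ t + 1) (hcex : maxCex t ≤ maxCex t₁)
    (hwl : w.length ≤ maxCex t₁) (hw : ¬ (w ∈ S.detHyp.lang ↔ w ∈ L)) :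
    ∃ S' t', (S.detRefine w).exec Te t₁ = (S', t') ∧ S'.DetInv L t' ∧
      S.detPot L < S'.detPot L := by
  obtain ⟨T₁, t₂, h₁, h₂, h₃, -⟩ := exec_askAll Te [w] S.T t₁
  have hT₁ := h₂.valid h.valid
  have hwk : Known T₁ w := h₃ w List.mem_cons_self
  have hvw := hT₁.val_iff hwk
  let P : ℕ → Prop := fun i => ¬ (S.run (w.take i) ++ w.drop i ∈ L ↔ w ∈ L)
  have hP0 : ¬ P 0 := fun h => h Iff.rfl
  have hPl : P w.length := by
    simp only [P, List.take_length, List.drop_length, List.append_nil]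
    rwa [← hS.mem_lang_detHyp h.proper hc]
  have hpos : 0 < w.length := Nat.pos_of_ne_zero fun h0 => hP0 (h0 ▸ hPl)
  obtain ⟨r, T', t', h₄, -, h₅, h₆, h₇, h₈⟩ := exec_bsearch Te
    (ws := fun i => [S.run (w.take i) ++ w.drop i])
    (test := fun T' i => val T' (S.run (w.take i) ++ w.drop i) != val T₁ w) (P := P) (T₀ := T₁)
    (k := 1) (c := 0) (fun _ => le_rfl)
    (fun T i hT _ hk => by
      rw [bne_iff_ne, Ne, Bool.eq_iff_iff, hvw, hT.val_iff (hk _ List.mem_cons_self)])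
    (fun i hi w' hw' => by
      obtain rfl : i = 0 := by omega
      rw [List.mem_singleton] at hw'
      rw [hw']
      exact hwk)
    0 w.length T₁ t₂ hT₁ (fun _ => id) hpos hP0 hPl
  have hrun := hS.run_mem h.proper hc (w.take r)
  obtain ⟨h₉, h₁₀⟩ := hS.next_spec hc hrun w[r]
  have hlt : S.detPot L < (S.addCol T' (w.drop (r + 1))).detPot L := by
    refine detPot_lt_addCol hfin T' (append_mem_rows hrun w[r]) (mem_rows_of_mem h₉) h₁₀
      fun he => h₇ ?_
    rw [← List.take_append_getElem h₅, run_append_singleton, ← he, List.append_assoc,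
      List.singleton_append, ← List.drop_eq_getElem_cons h₅]
    exact not_not.1 h₆
  refine ⟨S.addCol T' (w.drop (r + 1)), t', ?_, ?_, hlt⟩
  · rw [detRefine, Prog.exec_bind, h₁]
    dsimp only
    rw [Prog.exec_bind, h₄]
    rfl
  · have ha := (h₂.mono (p' := fun _ => True) le_rfl fun _ _ => trivial).trans h₈
    have hcl : ∀ {m m' : ℕ}, m ≤ m' → Nat.clog 2 m + 1 ≤ Nat.clog 2 m' + 1 := fun h =>
      Nat.add_le_add_right (Nat.clog_mono_right 2 h) 1
    rw [DetInv, ha.maxCex_eq]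
    refine h.addCol hMQ hEQ (hcl hcex) (ha.mono ?_ fun _ => id) hlt
    have := hcl (show w.length - max 0 0 ≤ maxCex t₁ by omega)
    rw [if_neg (lt_irrefl 0), List.length_singleton]
    omega

theorem exec_detAct {t : Transcript α} (h : S.DetInv L t) (hfin : (residuals L).Finite)
    (hS : S.Filled L) (Te : Teacher L) :
    (∃ S' t', S.detAct.exec Te t = (Sum.inl S', t') ∧ S'.DetInv L t' ∧
      S.detPot L < S'.detPot L) ∨
      ∃ H t', S.detAct.exec Te t = (Sum.inr H, t') ∧ H.lang = L ∧
        Nonempty (NFAIso H.toNFA (canonicalRFA L)) ∧ numMQ t' = numMQ t ∧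
        numEQ t' = numEQ t + 1 ∧ maxCex t' = maxCex t := by
  unfold detAct
  cases hu : S.newRow with
  | some x =>
    obtain ⟨hx, hne⟩ := hS.of_newRow_some hu
    have hlt := detPot_lt_addRow (S := S) hfin S.T x
    exact Or.inl ⟨_, t, rfl, h.addRow hlt hx hne, hlt⟩
  | none =>
    cases hr : Te.reply t S.detHyp with
    | none =>
      have hL := (Te.reply_none_iff t S.detHyp).1 hr
      rw [← hL] at hfin
      refine Or.inr ⟨S.detHyp.canonical, .equiv S.detHyp none :: t, ?_,
        (FinNFA.lang_canonical hfin).trans hL, ?_, rfl, rfl, rfl⟩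
      · simp only [Prog.exec, hr]
      · have := FinNFA.nonempty_iso_canonical hfin
        rwa [hL] at this
    | some w =>
      obtain ⟨h₁, h₂⟩ := length_le_maxCex_cons S.detHyp w t
      obtain ⟨S', t', h₃, h₄, h₅⟩ := exec_detRefine (t₁ := .equiv S.detHyp (some w) :: t) h hfin hS
        hu Te rfl le_rfl h₂ h₁ (Te.not_mem_iff hr)
      refine Or.inl ⟨S', t', ?_, h₄, h₅⟩
      simp only [Prog.exec, hr, Prog.exec_bind, h₃]

theorem exists_halts_detLearner {t : Transcript α} (h : S.DetInv L t)
    (hfin : (residuals L).Finite) (Te : Teacher L) :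
    ∃ H t', (detLearner α).Halts Te S t H t' ∧ H.lang = L ∧
      Nonempty (NFAIso H.toNFA (canonicalRFA L)) ∧ ∃ (S' : Obs α) (t₀ : Transcript α),
        S'.DetInv L t₀ ∧ numMQ t' = numMQ t₀ ∧ numEQ t' = numEQ t₀ + 1 ∧
          maxCex t' = maxCex t₀ := by
  induction hd : 2 * (residuals L).ncard - S.detPot L using Nat.strong_induction_on
    generalizing S t with
  | _ d ih =>
  obtain ⟨T', t₁, h₁, h₂, h₃, hm⟩ := h.fill Te
  have h₂' : DetInv L ⟨S.U, S.V, T'⟩ t₁ := by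
    rw [DetInv, hm]
    exact h₂
  have hround : ((detLearner α).round S).exec Te t = (detAct ⟨S.U, S.V, T'⟩).exec Te t₁ := by
    change ((askAll S.cells S.T).bind fun T => detAct ⟨S.U, S.V, T⟩).exec Te t = _
    rw [Prog.exec_bind, h₁]
  rcases exec_detAct h₂' hfin h₃ Te with ⟨S', t', h₄, h₅, h₆⟩ | ⟨H, t', h₄, h₅, h₆, h₇⟩
  · have hle := detPot_le hfin h₅.distinct
    have h₆' : S.detPot L < S'.detPot L := h₆
    obtain ⟨H, t'', h₈, h₉⟩ := ih _ (by omega) h₅ rfl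
    exact ⟨H, t'', .more (hround.trans h₄) h₈, h₉⟩
  · exact ⟨H, t', .done (hround.trans h₄), h₅, h₆, _, t₁, h₂', h₇⟩

end Obs

/-- Correctness and query complexity of `detLearner`. -/
theorem detLearner_run (α : Type) [FinEnum α] [Nonempty α] {L : Language α} (hL : L.IsRegular)
    (Te : Teacher L) : ∃ (H : FinNFA α) (t : Transcript α), (detLearner α).Run Te H t ∧
      H.lang = L ∧ Nonempty (NFAIso H.toNFA (canonicalRFA L)) ∧
      (numEQ t : ℝ) ≤ 40 * ((residuals L).ncard : ℝ) ^ 2 ∧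
      (numMQ t : ℝ) ≤ 40 * (((residuals L).ncard : ℝ) ^ 3 * (Fintype.card α : ℝ) +
        ((residuals L).ncard : ℝ) * Real.log (maxCex t : ℝ)) := by
  have hfin : (residuals L).Finite := hL.finite_range_leftQuotient
  obtain ⟨H, t, hrun, hlang, hiso, S, t₀, hinv, hMQ, hEQ, hcex⟩ :=
    Obs.exists_halts_detLearner (S := ⟨[[]], [[]], []⟩) (Obs.bounds_start _ _) hfin Te
  refine ⟨H, t, hrun, hlang, hiso, ?_⟩
  have hp := Obs.detPot_le hfin hinv.distinct
  have hM := hinv.numMQ_le hfin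
  have hE := hinv.numEQ_le
  rw [hMQ, hEQ, hcex]
  have hn : 1 ≤ (residuals L).ncard := residuals_ncard_pos hfin
  have hk : 1 ≤ Fintype.card α := Fintype.card_pos
  set n := (residuals L).ncard
  set k := Fintype.card α
  have hlog := clog_two_le (maxCex t₀)
  have hl := Real.log_natCast_nonneg (maxCex t₀)
  set l := Real.log (maxCex t₀)
  have hn' : (1 : ℝ) ≤ n := by exact_mod_cast hn
  have hk' : (1 : ℝ) ≤ k := by exact_mod_cast hk
  constructor
  · have : numEQ t₀ + 1 ≤ 40 * n ^ 2 := by nlinarith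
    exact_mod_cast this
  -- Progress is linear in `n` and each test takes one MQ, so the total is at most `6 * n ^ 2 * k +
  -- 4 * n + 4 * n * l`.
  · have h₁ : numMQ t₀ ≤ n * (1 + k) * (2 * n + 1) + 2 * n * (Nat.clog 2 (maxCex t₀) + 1) :=
      hM.trans (Nat.add_le_add (Nat.mul_le_mul_left _ (Nat.add_le_add_right hp 1))
        (Nat.mul_le_mul_right _ hp))
    have h₂ : (numMQ t₀ : ℝ) ≤ n * (1 + k) * (2 * n + 1) +
        2 * n * (Nat.clog 2 (maxCex t₀) + 1) := by exact_mod_cast h₁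
    have h₃ : (n : ℝ) * (1 + k) * (2 * n + 1) ≤ n * (k + k) * (2 * n + n) := by gcongr
    have h₄ : 2 * (n : ℝ) * (Nat.clog 2 (maxCex t₀) + 1) ≤ 2 * n * (1 + 2 * l + 1) := by gcongr
    have h₅ : (n : ℝ) ≤ n ^ 3 := le_self_pow₀ hn' (by norm_num)
    have h₆ : (n : ℝ) ^ 2 ≤ n ^ 3 := pow_le_pow_right₀ hn' (by norm_num)
    have h₇ : (n : ℝ) ^ 3 ≤ n ^ 3 * k := le_mul_of_one_le_right (by positivity) hk'
    have h₈ : (n : ℝ) ^ 2 * k ≤ n ^ 3 * k := by gcongr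
    have h₉ : 0 ≤ (n : ℝ) * l := by positivity
    nlinarith

end RFA

theorem corollary1 :
    ∃ C : ℝ, ∀ (α : Type) [FinEnum α] [Nonempty α],
      (∀ (L : Language α), L.IsRegular → ∀ T : RFA.Teacher L,
        ∃ (H : RFA.FinNFA α) (t : RFA.Transcript α),
          (RFA.binaryNLStar α).Run T H t ∧
          H.lang = L ∧ Nonempty (RFA.NFAIso H.toNFA (RFA.canonicalRFA L)) ∧
          (RFA.numEQ t : ℝ) ≤ C * ((RFA.residuals L).ncard : ℝ) ^ 2 ∧
          (RFA.numMQ t : ℝ) ≤ C * (((RFA.residuals L).ncard : ℝ) ^ 3 * (Fintype.card α : ℝ) +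
            ((RFA.residuals L).ncard : ℝ) ^ 3 * Real.log (RFA.maxCex t : ℝ))) ∧
      (∃ M : RFA.Learner α, ∀ (L : Language α), L.IsRegular → ∀ T : RFA.Teacher L,
        ∃ (H : RFA.FinNFA α) (t : RFA.Transcript α),
          M.Run T H t ∧
          H.lang = L ∧ Nonempty (RFA.NFAIso H.toNFA (RFA.canonicalRFA L)) ∧
          (RFA.numEQ t : ℝ) ≤ C * ((RFA.residuals L).ncard : ℝ) ^ 2 ∧
          (RFA.numMQ t : ℝ) ≤ C * (((RFA.residuals L).ncard : ℝ) ^ 3 * (Fintype.card α : ℝ) +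
            ((RFA.residuals L).ncard : ℝ) * Real.log (RFA.maxCex t : ℝ))) :=
  ⟨40, fun α _ _ => ⟨fun _ hL Te => RFA.binaryNLStar_run α hL Te,
    RFA.detLearner α, fun _ hL Te => RFA.detLearner_run α hL Te⟩⟩
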